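/- Let $m$ nodes form a connected graph, and let $W=[w_{il}]\in\mathbb R^{m\times m}$ be a mixing matrix of it: $w_{il}>0$ if $i=l$ or $i,l$ are adjacent and $w_{il}=0$ otherwise, $W=W^\top$, $\mathrm{null}(I-W)=\mathrm{span}\{\mathbf 1\}$, $I\succeq W\succ -I$. Node $i$ holds functions $f_i^1,\dots,f_i^M:\mathbb R^n\to\mathbb R$; put $f_i=\frac1M\sum_{s=1}^M f_i^s$ and $f=\frac1m\sum_{i=1}^m f_i$. Assume that every $f_i$ is bounded below, and that all $f_i^s$ are differentiable with $\|\nabla f_i^s(x)\|\le B$ and $\|\nabla f_i^s(x)-\nabla f_i^s(y)\|\le L\|x-y\|$ for all $x,y$. Let $H$ be an irreducible, aperiodic stochastic $M\times M$ matrix whose stationary distribution is uniform on $\{1,\dots,M\}$. For every node $i$ let $(j_{i,k})_{k\ge0}$ be a time-homogeneous Markov chain with transition matrix $H$ (the Markov property holding relative to the samples and directions of all nodes up to the present time), and let $\mathbf h^{i,k}$ be uniform on the unit sphere of $\mathbb R^n$ and independent of all samples up to time $k$ and all directions before time $k$. Let $\gamma_k=(k+1)^{-\theta}$ with $\frac12<\theta<1$,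 and $\delta_k>0$ with $\sum_k\gamma_k\delta_k<\infty$. The zeroth-order DMGD iterates are $\mathbf x^0(i)=x^0$ and $$\mathbf x^{k+1}(i)=\sum_{l} w_{il}\,\mathbf x^k(l)-\gamma_k\,\frac{n\big(f_i^{j_{i,k}}(\mathbf x^k(i)+\delta_k\mathbf h^{i,k})-f_i^{j_{i,k}}(\mathbf x^k(i))\big)}{\delta_k}\,\mathbf h^{i,k},\qquad \overline{x^k}:=\frac1m\sum_{i=1}^m\mathbf x^k(i).$$ Let $\lambda_2(W)$ be the second largest absolute value of an eigenvalue of $W$ ($0$ if $m=1$), and let $\lambda(H)=\frac{\rho+1}{2}$, where $\rho$ is the second largest absolute value of a complex eigenvalue of $H$ ($0$ if $M=1$). Then $$\lim_{k\to\infty}\mathbb E\|\nabla f(\overline{x^k})\|=0,$$ and for all $k\ge1$ $$\min_{1\le i\le k}\mathbb E\|\nabla f(\overline{x^i})\|\le C\cdot\frac{\frac{1}{\ln(1/\lambda(H))}\cdot\frac{1}{1-\lambda_2(W)}+n^{3/2}}{k^{(1-\theta)/2}},$$ where $C$ depends only on $m$, $M$, $\theta$, $B$, $L$ and on upper bounds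 for $f(x^0)-\inf f$ and $\sum_k\gamma_k\delta_k$; in particular $C$ does not depend on $n$, $W$ or $H$. -/

import Mathlib

open MeasureTheory ProbabilityTheory Filter Topology
open scoped Gradient

noncomputable section

/-- `ℝⁿ` with its Euclidean norm. -/
abbrev Rn (n : ℕ) : Type := EuclideanSpace ℝ (Fin n)

/-- The unit sphere of `ℝⁿ`. -/
abbrev UnitSphere (n : ℕ) : Type := Metric.sphere (0 : Rn n) 1

/-- The uniform distribution on the unit sphere: normalized surface measure. -/
def sphereUniform (n : ℕ) : Measure (UnitSphere n) :=
  ProbabilityTheory.cond (volume : Measure (Rn n)).toSphere Set.univ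

/-! ### Matrices -/

/-- `W` is a mixing matrix of the graph `G` (the diagonal entries are positive as well). -/
structure IsMixingMatrix {m : ℕ} (G : SimpleGraph (Fin m)) (W : Matrix (Fin m) (Fin m) ℝ) :
    Prop where
  zero_of_not_adj : ∀ i l, i ≠ l → ¬ G.Adj i l → W i l = 0
  pos_of_adj : ∀ i l, (i = l ∨ G.Adj i l) → 0 < W i l
  symm : W.IsSymm
  null_space : LinearMap.ker (Matrix.toLin' (1 - W)) = Submodule.span ℝ {fun _ => (1 : ℝ)}
  le_one : (1 - W).PosSemidef
  neg_one_lt : (1 + W).PosDef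

/-- Irreducibility of a transition matrix. -/
def IsIrreducibleChain {M : ℕ} (H : Matrix (Fin M) (Fin M) ℝ) : Prop :=
  ∀ r s, ∃ k : ℕ, 0 < (H ^ k) r s

/-- Aperiodicity of a transition matrix: every state has period one, that is, `1` is the only
`d` that divides all the return times of the state. -/
def IsAperiodicChain {M : ℕ} (H : Matrix (Fin M) (Fin M) ℝ) : Prop :=
  ∀ r, ∀ d : ℕ, (∀ k : ℕ, 0 < (H ^ k) r r → d ∣ k) → d = 1

/-- A stochastic, irreducible, aperiodic transition matrix whose stationary distribution is the
uniform one. -/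
structure IsErgodicUniform {M : ℕ} (H : Matrix (Fin M) (Fin M) ℝ) : Prop where
  stochastic : H ∈ Matrix.rowStochastic ℝ (Fin M)
  irreducible : IsIrreducibleChain H
  aperiodic : IsAperiodicChain H
  stationary : Matrix.vecMul (fun _ => 1 / (M : ℝ)) H = fun _ => 1 / (M : ℝ)

/-- The largest absolute value of the (complex) eigenvalues of `A` other than `1`; it is `0` if
there are none. The eigenvalue `1` is simple for the matrices to which this is applied, and so
this is the second largest absolute value of an eigenvalue. -/
def secondModulus {N : ℕ} (A : Matrix (Fin N) (Fin N) ℝ) : ℝ :=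
  sSup ((fun z : ℂ => ‖z‖) '' (spectrum ℂ (A.map (algebraMap ℝ ℂ)) \ {1}))

/-- `λ(H)`: the mean of `1` and the second largest absolute value of an eigenvalue of `H`. -/
def lambdaH {M : ℕ} (H : Matrix (Fin M) (Fin M) ℝ) : ℝ := (secondModulus H + 1) / 2

/-! ### The objective -/

/-- The loss of node `i`, the average of its `M` sample losses. -/
def nodeLoss {n m M : ℕ} (f : Fin m → Fin M → Rn n → ℝ) (i : Fin m) (x : Rn n) : ℝ :=
  (1 / (M : ℝ)) * ∑ s, f i s x

/-- The objective, the average of the losses of the nodes. -/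
def objective {n m M : ℕ} (f : Fin m → Fin M → Rn n → ℝ) (x : Rn n) : ℝ :=
  (1 / (m : ℝ)) * ∑ i, nodeLoss f i x

/-- Every node loss is bounded below; the sample losses are differentiable, with gradients that
are bounded by `B` and Lipschitz continuous with constant `L`. -/
structure LossAssumptions {n m M : ℕ} (B L : ℝ) (f : Fin m → Fin M → Rn n → ℝ) : Prop where
  bddBelow : ∀ i, BddBelow (Set.range (nodeLoss f i))
  differentiable : ∀ i s, Differentiable ℝ (f i s)
  gradient_bound : ∀ i s x, ‖∇ (f i s) x‖ ≤ B
  gradient_lipschitz : ∀ i s x y, ‖∇ (f i s) x - ∇ (f i s) y‖ ≤ L * ‖x - y‖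

/-! ### The algorithm -/

/-- The two-point estimator `n (g (x + δ h) - g x) / δ · h` of the gradient of `g` at `x`. -/
def twoPoint {n : ℕ} (g : Rn n → ℝ) (δ : ℝ) (h x : Rn n) : Rn n :=
  ((n : ℝ) * (g (x + δ • h) - g x) / δ) • h

/-- The iterates `x^k(i)` of zeroth-order DMGD, started at `x⁰` in every node, along the samples
`j i k` and the directions `h i k`. As `W i l = 0` unless `l` is `i` or a neighbour of `i`, the
sum runs over all nodes. -/
def zoDMGD {n m M : ℕ} (W : Matrix (Fin m) (Fin m) ℝ) (f : Fin m → Fin M → Rn n → ℝ)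
    (γ δ : ℕ → ℝ) (x₀ : Rn n) (j : Fin m → ℕ → Fin M) (h : Fin m → ℕ → UnitSphere n) :
    ℕ → Fin m → Rn n
  | 0, _ => x₀
  | k + 1, i =>
      ∑ l, W i l • zoDMGD W f γ δ x₀ j h k l
        - γ k • twoPoint (f i (j i k)) (δ k) (h i k : Rn n) (zoDMGD W f γ δ x₀ j h k i)

/-- The average of the local variables. -/
def nodeAverage {n m : ℕ} (x : Fin m → Rn n) : Rn n := (1 / (m : ℝ)) • ∑ i, x i

/-! ### The random samples -/

/-- The information generated by all samples and directions up to and including time `k`. -/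
@[reducible] def history {Ω : Type*} {n m M : ℕ} (j : Fin m → ℕ → Ω → Fin M)
    (h : Fin m → ℕ → Ω → UnitSphere n) (k : ℕ) : MeasurableSpace Ω :=
  ⨆ (i : Fin m) (l : ℕ) (_ : l ≤ k),
    MeasurableSpace.comap (j i l) inferInstance ⊔ MeasurableSpace.comap (h i l) inferInstance

/-- The information available when the directions of time `k` are drawn: all samples up to and
including time `k`, and all directions before time `k`. -/
@[reducible] def preHistory {Ω : Type*} {n m M : ℕ} (j : Fin m → ℕ → Ω → Fin M)
    (h : Fin m → ℕ → Ω → UnitSphere n) (k : ℕ) : MeasurableSpace Ω :=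
  (⨆ (i : Fin m) (l : ℕ) (_ : l ≤ k), MeasurableSpace.comap (j i l) inferInstance) ⊔
    ⨆ (i : Fin m) (l : ℕ) (_ : l < k), MeasurableSpace.comap (h i l) inferInstance

/-- `X` is a time-homogeneous Markov chain with transition matrix `H` relative to the increasing
information `ℱ`: given `ℱ k`, the state at time `k + 1` has the distribution `H (X k) ·`. -/
def IsMarkovChain {Ω : Type*} [MeasurableSpace Ω] {M : ℕ} (P : Measure Ω)
    (ℱ : ℕ → MeasurableSpace Ω) (H : Matrix (Fin M) (Fin M) ℝ) (X : ℕ → Ω → Fin M) : Prop :=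
  ∀ (k : ℕ) (r s : Fin M) (A : Set Ω), MeasurableSet[ℱ k] A →
    P.real (A ∩ {ω | X k ω = r} ∩ {ω | X (k + 1) ω = s})
      = P.real (A ∩ {ω | X k ω = r}) * H r s

/-- The samples of every node form a Markov chain with transition matrix `H`; every direction is
uniform on the unit sphere, and it is drawn independently of what has happened before. -/
structure IsSampling {Ω : Type*} [MeasurableSpace Ω] {n m M : ℕ} (P : Measure Ω)
    (H : Matrix (Fin M) (Fin M) ℝ) (j : Fin m → ℕ → Ω → Fin M)
    (h : Fin m → ℕ → Ω → UnitSphere n) : Prop where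
  measurable_sample : ∀ i k, Measurable (j i k)
  measurable_direction : ∀ i k, Measurable (h i k)
  markov : ∀ i, IsMarkovChain P (history j h) H (j i)
  uniform : ∀ i k, P.map (h i k) = sphereUniform n
  indep : ∀ i k, Indep (MeasurableSpace.comap (h i k) inferInstance) (preHistory j h k) P

end

/-!
The averages `x̄ᵏ` perform inexact gradient descent on the objective `f`: as `W` fixes the
constants, averaging over the nodes removes it from the recursion. The gradient step deviates from
`∇ f x̄ᵏ` for four reasons, and for each of them the deviations, weighted by `γ k`, sum to a finite
quantity.

* The difference quotient is a derivative up to `O(δ k)`.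
* The direction is uniform, so `n ⟪g, h⟫ h` has expectation `g`; it is independent of the past, so
  this deviation vanishes in expectation.
* The local variables differ from their average by at most a geometric sum with ratio `λ₂(W)` of
  the preceding step sizes.
* The samples are correlated in time. With the fundamental matrix of `H`, a solution of the Poisson
  equation `q - H q = φ` turns the sum of the deviations `φ (j k) (x̄ᵏ)` into martingale differences
  and a telescoping sum, up to increments of `γ` and of `x̄`.

Hence `∑ k, γ k * E ‖∇ f x̄ᵏ‖ ^ 2` is finite, and the step sizes up to `k` sum to at least
`k ^ (1 - θ) / 2`, which gives the rate. The limit is zero because `aₖ = E ‖∇ f x̄ᵏ‖` changes by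
`O(γ k)` in a step, so that `aₖ ^ 3` is a Cauchy sequence.
-/

open scoped Matrix

/-! ### Spectra of real matrices -/

section Spectrum

variable {ι K : Type*} [Fintype ι] [DecidableEq ι]

theorem mem_spectrum_iff_exists_mulVec_eq_smul [Field K] {A : Matrix ι ι K} {z : K} :
    z ∈ spectrum K A ↔ ∃ v ≠ 0, A *ᵥ v = z • v := by
  rw [← Matrix.spectrum_toLin', ← Module.End.hasEigenvalue_iff_mem_spectrum]
  refine ⟨fun h => ?_, fun ⟨v, hv, h⟩ => ?_⟩
  · obtain ⟨v, hv⟩ := h.exists_hasEigenvector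
    exact ⟨v, hv.2, hv.apply_eq_smul⟩
  · exact Module.End.hasEigenvalue_of_hasEigenvector (x := v)
      ⟨Module.End.mem_eigenspace_iff.mpr h, hv⟩

theorem ofReal_mem_spectrum_iff {A : Matrix ι ι ℝ} {y : ℝ} :
    (y : ℂ) ∈ spectrum ℂ (A.map (algebraMap ℝ ℂ)) ↔ y ∈ spectrum ℝ A := by
  rw [Matrix.mem_spectrum_iff_isRoot_charpoly, Matrix.mem_spectrum_iff_isRoot_charpoly,
    Matrix.charpoly_map]
  exact Polynomial.isRoot_map_iff (algebraMap ℝ ℂ).injective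

theorem norm_trace_le_of_spectrum {A : Matrix ι ι ℂ} {R : ℝ} (h : ∀ z ∈ spectrum ℂ A, ‖z‖ ≤ R) :
    ‖A.trace‖ ≤ Fintype.card ι * R := by
  have hcard : Multiset.card (A.charpoly.roots.map norm) = Fintype.card ι := by
    rw [Multiset.card_map, ← (IsAlgClosed.splits A.charpoly).natDegree_eq_card_roots,
      Matrix.charpoly_natDegree_eq_dim]
  calc ‖A.trace‖ ≤ (A.charpoly.roots.map norm).sum := by
        rw [Matrix.trace_eq_sum_roots_charpoly]
        exact norm_multiset_sum_le _
    _ ≤ Multiset.card (A.charpoly.roots.map norm) • R := by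
        refine Multiset.sum_le_card_nsmul _ _ fun x hx => ?_
        obtain ⟨z, hz, rfl⟩ := Multiset.mem_map.mp hx
        exact h z (Matrix.mem_spectrum_of_isRoot_charpoly (Polynomial.isRoot_of_mem_roots hz))
    _ = Fintype.card ι * R := by rw [hcard, nsmul_eq_mul]

theorem abs_trace_le_of_spectrum {A : Matrix ι ι ℝ} {R : ℝ}
    (h : ∀ z ∈ spectrum ℂ (A.map (algebraMap ℝ ℂ)), ‖z‖ ≤ R) : |A.trace| ≤ Fintype.card ι * R := by
  have htrace : (A.map (algebraMap ℝ ℂ)).trace = (A.trace : ℂ) := by simp [Matrix.trace]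
  simpa only [htrace, Complex.norm_real, Real.norm_eq_abs] using norm_trace_le_of_spectrum h

theorem abs_trace_mul_self_le_of_spectrum {A : Matrix ι ι ℝ} {R : ℝ}
    (h : ∀ z ∈ spectrum ℂ (A.map (algebraMap ℝ ℂ)), ‖z‖ ≤ R) :
    |(A * A).trace| ≤ Fintype.card ι * R ^ 2 := by
  refine abs_trace_le_of_spectrum fun z hz => ?_
  rw [Matrix.map_mul, ← pow_two, spectrum.map_pow_of_pos _ two_pos] at hz
  obtain ⟨y, hy, rfl⟩ := hz
  simpa only [norm_pow] using pow_le_pow_left₀ (norm_nonneg y) (h y hy) 2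

end Spectrum

section SecondModulus

variable {N : ℕ} {A : Matrix (Fin N) (Fin N) ℝ}

theorem finite_norm_image_spectrum (A : Matrix (Fin N) (Fin N) ℝ) :
    ((fun z : ℂ => ‖z‖) '' (spectrum ℂ (A.map (algebraMap ℝ ℂ)) \ {1})).Finite :=
  ((Matrix.finite_spectrum _).subset Set.sdiff_subset).image _

theorem norm_le_secondModulus {z : ℂ} (hz : z ∈ spectrum ℂ (A.map (algebraMap ℝ ℂ)))
    (hz1 : z ≠ 1) : ‖z‖ ≤ secondModulus A :=
  le_csSup (finite_norm_image_spectrum A).bddAbove ⟨z, ⟨hz, hz1⟩, rfl⟩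

theorem secondModulus_nonneg (A : Matrix (Fin N) (Fin N) ℝ) : 0 ≤ secondModulus A := by
  refine Real.sSup_nonneg ?_
  rintro _ ⟨z, -, rfl⟩
  exact norm_nonneg z

theorem secondModulus_lt_one
    (h : ∀ z ∈ spectrum ℂ (A.map (algebraMap ℝ ℂ)), z ≠ 1 → ‖z‖ < 1) : secondModulus A < 1 := by
  rw [secondModulus]
  rcases Set.eq_empty_or_nonempty
    ((fun z : ℂ => ‖z‖) '' (spectrum ℂ (A.map (algebraMap ℝ ℂ)) \ {1})) with hempty | hne
  · rw [hempty, Real.sSup_empty]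
    exact one_pos
  · obtain ⟨z, ⟨hz, hz1⟩, hmax⟩ := hne.csSup_mem (finite_norm_image_spectrum A)
    exact hmax ▸ h z hz hz1

end SecondModulus

section AccretiveMatrix

theorem sum_sub_transpose_sq {ι : Type*} [Fintype ι] (Z : Matrix ι ι ℝ) :
    ∑ i, ∑ j, (Z i j - Z j i) ^ 2 = ∑ i, ∑ j, (Z i j + Z j i) ^ 2 - 4 * (Z * Z).trace := by
  simp only [Matrix.trace, Matrix.diag_apply, Matrix.mul_apply, Finset.mul_sum,
    ← Finset.sum_sub_distrib]
  exact Finset.sum_congr rfl fun i _ => Finset.sum_congr rfl fun j _ => by ring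

variable {ι : Type*} [Fintype ι] {Z : Matrix ι ι ℝ}

theorem apply_self_nonneg_of_accretive (hZ : ∀ v, 0 ≤ v ⬝ᵥ Z *ᵥ v) (i : ι) : 0 ≤ Z i i := by
  classical
  simpa [Matrix.mulVec_single] using hZ (Pi.single i 1)

theorem abs_add_transpose_le_of_accretive (hZ : ∀ v, 0 ≤ v ⬝ᵥ Z *ᵥ v) (i j : ι) :
    |Z i j + Z j i| ≤ Z i i + Z j j := by
  classical
  have hadd := hZ (Pi.single i 1 + Pi.single j 1)
  have hsub := hZ (Pi.single i 1 - Pi.single j 1)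
  simp only [Matrix.mulVec_add, Matrix.mulVec_sub, Matrix.mulVec_single, MulOpposite.op_one,
    one_smul, dotProduct_add, add_dotProduct, dotProduct_sub, sub_dotProduct, single_dotProduct,
    Matrix.col_apply, one_mul] at hadd hsub
  rw [abs_le]
  constructor <;> linarith

theorem abs_add_transpose_le_two_mul_trace (hZ : ∀ v, 0 ≤ v ⬝ᵥ Z *ᵥ v) (i j : ι) :
    |Z i j + Z j i| ≤ 2 * Z.trace := by
  have hdiag : ∀ i, Z i i ≤ Z.trace := fun i =>
    Finset.single_le_sum (f := fun i => Z i i) (fun i _ => apply_self_nonneg_of_accretive hZ i)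
      (Finset.mem_univ i)
  linarith [abs_add_transpose_le_of_accretive hZ i j, hdiag i, hdiag j]

-- The symmetric part is bounded by the trace of `Z`, the antisymmetric part by that of `Z ^ 2`.
theorem abs_apply_le_of_accretive [DecidableEq ι] {R : ℝ} (hZ : ∀ v, 0 ≤ v ⬝ᵥ Z *ᵥ v) (hR0 : 0 ≤ R)
    (hR : ∀ z ∈ spectrum ℂ (Z.map (algebraMap ℝ ℂ)), ‖z‖ ≤ R) (r s : ι) :
    |Z r s| ≤ (2 * (Fintype.card ι : ℝ) ^ 2 + 2) * R := by
  set c := (Fintype.card ι : ℝ)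
  have : 0 ≤ c := Nat.cast_nonneg _
  have hsym : ∀ i j, |Z i j + Z j i| ≤ 2 * (c * R) := fun i j => by
    linarith [abs_add_transpose_le_two_mul_trace hZ i j, le_abs_self Z.trace,
      abs_trace_le_of_spectrum hR]
  have hskew_sq : (Z r s - Z s r) ^ 2 ≤ ((2 * c ^ 2 + 2) * R) ^ 2 :=
    calc (Z r s - Z s r) ^ 2 ≤ ∑ j, (Z r j - Z j r) ^ 2 :=
          Finset.single_le_sum (f := fun j => (Z r j - Z j r) ^ 2) (fun _ _ => sq_nonneg _)
            (Finset.mem_univ s)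
      _ ≤ ∑ i, ∑ j, (Z i j - Z j i) ^ 2 :=
          Finset.single_le_sum (f := fun i => ∑ j, (Z i j - Z j i) ^ 2)
            (fun _ _ => Finset.sum_nonneg fun _ _ => sq_nonneg _) (Finset.mem_univ r)
      _ = ∑ i, ∑ j, (Z i j + Z j i) ^ 2 - 4 * (Z * Z).trace := sum_sub_transpose_sq Z
      _ ≤ ∑ _i : ι, ∑ _j : ι, (2 * (c * R)) ^ 2 + 4 * (c * R ^ 2) := by
          have hsum := Finset.sum_le_sum fun i (_ : i ∈ Finset.univ) =>
            Finset.sum_le_sum fun j (_ : j ∈ Finset.univ) =>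
              sq_le_sq' (neg_le_of_abs_le (hsym i j)) (le_of_abs_le (hsym i j))
          linarith [neg_abs_le (Z * Z).trace, abs_trace_mul_self_le_of_spectrum hR]
      _ = (4 * c ^ 4 + 4 * c) * R ^ 2 := by
          simp only [Finset.sum_const, Finset.card_univ, nsmul_eq_mul]
          ring
      _ ≤ (2 * c ^ 2 + 2) ^ 2 * R ^ 2 := by
          gcongr
          nlinarith [sq_nonneg (c - 1)]
      _ = ((2 * c ^ 2 + 2) * R) ^ 2 := by ring
  have hskew := abs_le_of_sq_le_sq hskew_sq (by positivity)
  have hsplit : 2 * |Z r s| ≤ |Z r s + Z s r| + |Z r s - Z s r| := by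
    have := abs_add_le (Z r s + Z s r) (Z r s - Z s r)
    rwa [show Z r s + Z s r + (Z r s - Z s r) = 2 * Z r s by ring, abs_mul, abs_two] at this
  nlinarith [hsym r s, mul_nonneg (sq_nonneg (c - 1)) hR0]

end AccretiveMatrix

section ColumnSums

variable {ι K : Type*} [Fintype ι]

theorem sum_mulVec_of_one_vecMul [Semiring K] {A : Matrix ι ι K} (hA : 1 ᵥ* A = 1)
    (v : ι → K) : ∑ i, (A *ᵥ v) i = ∑ i, v i := by
  rw [← one_dotProduct, Matrix.dotProduct_mulVec, hA, one_dotProduct]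

theorem sum_eq_zero_of_mulVec_eq_smul [Field K] {A : Matrix ι ι K} (hA : 1 ᵥ* A = 1) {v : ι → K}
    {y : K} (hv : A *ᵥ v = y • v) (hy : y ≠ 1) : ∑ i, v i = 0 := by
  have h := sum_mulVec_of_one_vecMul hA v
  simp only [hv, Pi.smul_apply, smul_eq_mul, ← Finset.mul_sum] at h
  exact (mul_left_eq_self₀.mp h).resolve_left hy

end ColumnSums

section ConvexCombination

theorem eq_of_convex_combination_eq {ι E : Type*} [Fintype ι] [NormedAddCommGroup E]
    [InnerProductSpace ℝ E] {p : ι → ℝ} (hp : ∀ s, 0 ≤ p s) (hp1 : ∑ s, p s = 1) {v : ι → E}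
    {w : E} (hv : ∀ s, ‖v s‖ ≤ ‖w‖) (hw : ∑ s, p s • v s = w) {s : ι} (hs : 0 < p s) :
    v s = w := by
  have hinner : ∀ t, inner ℝ w (v t) ≤ ‖w‖ ^ 2 := fun t =>
    (real_inner_le_norm w (v t)).trans
      ((mul_le_mul_of_nonneg_left (hv t) (norm_nonneg w)).trans_eq (pow_two _).symm)
  have hdefect : ∑ t, p t * (‖w‖ ^ 2 - inner ℝ w (v t)) = 0 := by
    have hsum : ∑ t, p t * inner ℝ w (v t) = ‖w‖ ^ 2 := by
      simp only [← real_inner_smul_right, ← inner_sum, hw, real_inner_self_eq_norm_sq]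
    rw [Finset.sum_congr rfl fun t _ => mul_sub _ _ _, Finset.sum_sub_distrib, ← Finset.sum_mul,
      hp1, one_mul, hsum, sub_self]
  have hterm := (Finset.sum_eq_zero_iff_of_nonneg fun t _ =>
    mul_nonneg (hp t) (sub_nonneg.mpr (hinner t))).mp hdefect s (Finset.mem_univ s)
  have heq : inner ℝ w (v s) = ‖w‖ ^ 2 :=
    (sub_eq_zero.mp ((mul_eq_zero.mp hterm).resolve_left hs.ne')).symm
  have hdist : ‖w - v s‖ ^ 2 ≤ 0 := by
    rw [norm_sub_sq_real, heq]
    linarith [pow_le_pow_left₀ (norm_nonneg _) (hv s) 2]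
  exact (sub_eq_zero.mp (norm_eq_zero.mp (sq_nonpos_iff _ |>.mp hdist))).symm

end ConvexCombination

/-! ### Ergodic stochastic matrices -/

section Stochastic

variable {ι : Type*} [Fintype ι] [DecidableEq ι] {H : Matrix ι ι ℝ}

theorem norm_le_one_of_mem_spectrum_rowStochastic (hH : H ∈ Matrix.rowStochastic ℝ ι) {z : ℂ}
    (hz : z ∈ spectrum ℂ (H.map (algebraMap ℝ ℂ))) : ‖z‖ ≤ 1 := by
  obtain ⟨v, hv, hHv⟩ := mem_spectrum_iff_exists_mulVec_eq_smul.mp hz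
  obtain ⟨s, hs⟩ := Function.ne_iff.mp hv
  have : Nonempty ι := ⟨s⟩
  obtain ⟨r, hr⟩ := Finite.exists_max fun s => ‖v s‖
  have hpos : 0 < ‖v r‖ := (norm_pos_iff.mpr hs).trans_le (hr s)
  have hcomb : z * v r = ∑ t, (H r t : ℂ) * v t := (congrFun hHv r).symm
  refine le_of_mul_le_mul_right ?_ hpos
  calc ‖z‖ * ‖v r‖ ≤ ∑ t, ‖(H r t : ℂ) * v t‖ := by
        rw [← norm_mul, hcomb]
        exact norm_sum_le _ _
    _ ≤ ∑ t, H r t * ‖v r‖ := by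
        refine Finset.sum_le_sum fun t _ => ?_
        have h0 := Matrix.nonneg_of_mem_rowStochastic hH (i := r) (j := t)
        rw [norm_mul, Complex.norm_of_nonneg h0]
        exact mul_le_mul_of_nonneg_left (hr t) h0
    _ = 1 * ‖v r‖ := by rw [← Finset.sum_mul, Matrix.sum_row_of_mem_rowStochastic hH r]

theorem map_pow_mulVec_eq_smul {v : ι → ℂ} {z : ℂ} (hv : H.map (algebraMap ℝ ℂ) *ᵥ v = z • v)
    (k : ℕ) : (H ^ k).map (algebraMap ℝ ℂ) *ᵥ v = z ^ k • v := by
  induction k with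
  | zero => simp [Matrix.map_one]
  | succ k ih =>
    rw [pow_succ, Matrix.map_mul, ← Matrix.mulVec_mulVec, hv, Matrix.mulVec_smul, ih, smul_smul,
      pow_succ']

-- At a state `r` where `‖v‖` is maximal, the mean `z ^ k * v r` of `v` over `H ^ k` is extremal.
theorem exists_eigenvector_eq_pow_mul (hH : H ∈ Matrix.rowStochastic ℝ ι) {v : ι → ℂ} (hv : v ≠ 0)
    {z : ℂ} (hz : ‖z‖ = 1) (hHv : H.map (algebraMap ℝ ℂ) *ᵥ v = z • v) :
    ∃ r, v r ≠ 0 ∧ ∀ k s, 0 < (H ^ k) r s → v s = z ^ k * v r := by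
  obtain ⟨s, hs⟩ := Function.ne_iff.mp hv
  have : Nonempty ι := ⟨s⟩
  obtain ⟨r, hr⟩ := Finite.exists_max fun s => ‖v s‖
  refine ⟨r, norm_pos_iff.mp ((norm_pos_iff.mpr hs).trans_le (hr s)), fun k s hks => ?_⟩
  have hk : H ^ k ∈ Matrix.rowStochastic ℝ ι := pow_mem hH k
  refine eq_of_convex_combination_eq (p := (H ^ k) r)
    (fun _ => Matrix.nonneg_of_mem_rowStochastic hk) (Matrix.sum_row_of_mem_rowStochastic hk r)
    (fun t => ?_) ?_ hks
  · simpa [hz] using hr t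
  · simpa [Matrix.mulVec, dotProduct] using congrFun (map_pow_mulVec_eq_smul hHv k) r

theorem dotProduct_mulVec_le_of_doublyStochastic (hH : H ∈ doublyStochastic ℝ ι) (v : ι → ℝ) :
    v ⬝ᵥ H *ᵥ v ≤ v ⬝ᵥ v := by
  have hrow : ∑ a, ∑ b, H a b * v a ^ 2 = v ⬝ᵥ v := by
    simp only [← Finset.sum_mul, sum_row_of_mem_doublyStochastic hH, one_mul, dotProduct, pow_two]
  have hcol : ∑ a, ∑ b, H a b * v b ^ 2 = v ⬝ᵥ v := by
    rw [Finset.sum_comm]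
    simp only [← Finset.sum_mul, sum_col_of_mem_doublyStochastic hH, one_mul, dotProduct, pow_two]
  calc v ⬝ᵥ H *ᵥ v = ∑ a, ∑ b, H a b * (v a * v b) := by
        simp only [dotProduct, Matrix.mulVec, Finset.mul_sum]
        exact Finset.sum_congr rfl fun a _ => Finset.sum_congr rfl fun b _ => by ring
    _ ≤ ∑ a, ∑ b, (H a b * v a ^ 2 + H a b * v b ^ 2) / 2 :=
        Finset.sum_le_sum fun a _ => Finset.sum_le_sum fun b _ => by
          nlinarith [mul_nonneg (nonneg_of_mem_doublyStochastic hH (i := a) (j := b))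
            (sq_nonneg (v a - v b))]
    _ = v ⬝ᵥ v := by
        simp only [← Finset.sum_div, Finset.sum_add_distrib, hrow, hcol, add_self_div_two]

end Stochastic

namespace IsErgodicUniform

variable {M : ℕ} {H : Matrix (Fin M) (Fin M) ℝ}

theorem mem_doublyStochastic (hH : IsErgodicUniform H) : H ∈ doublyStochastic ℝ (Fin M) := by
  refine mem_doublyStochastic_iff_sum.mpr
    ⟨fun _ _ => Matrix.nonneg_of_mem_rowStochastic hH.stochastic,
      Matrix.sum_row_of_mem_rowStochastic hH.stochastic, fun s => ?_⟩
  have hM : (M : ℝ) ≠ 0 := Nat.cast_ne_zero.mpr s.pos.ne'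
  have h := congrFun hH.stationary s
  simp only [Matrix.vecMul, dotProduct, ← Finset.mul_sum] at h
  field_simp at h
  exact h

theorem eigenvalue_eq_one_of_norm_eq_one (hH : IsErgodicUniform H) {v : Fin M → ℂ} (hv : v ≠ 0)
    {z : ℂ} (hz : ‖z‖ = 1) (hHv : H.map (algebraMap ℝ ℂ) *ᵥ v = z • v) : z = 1 := by
  obtain ⟨r, hr, hpow⟩ := exists_eigenvector_eq_pow_mul hH.stochastic hv hz hHv
  rw [← orderOf_eq_one_iff]
  exact hH.aperiodic r _ fun k hk =>
    orderOf_dvd_of_pow_eq_one (mul_right_cancel₀ hr ((hpow k r hk).symm.trans (one_mul _).symm))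

theorem eq_of_mulVec_eq_self (hH : IsErgodicUniform H) {v : Fin M → ℂ}
    (hHv : H.map (algebraMap ℝ ℂ) *ᵥ v = v) (r s : Fin M) : v r = v s := by
  by_cases hv : v = 0
  · simp [hv]
  obtain ⟨t, -, hpow⟩ :=
    exists_eigenvector_eq_pow_mul hH.stochastic hv norm_one (hHv.trans (one_smul ℂ v).symm)
  have hconst : ∀ s, v s = v t := fun s => by
    obtain ⟨k, hk⟩ := hH.irreducible t s
    simpa using hpow k s hk
  rw [hconst r, hconst s]

theorem secondModulus_lt_one (hH : IsErgodicUniform H) : secondModulus H < 1 := by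
  refine _root_.secondModulus_lt_one fun z hz hz1 =>
    (norm_le_one_of_mem_spectrum_rowStochastic hH.stochastic hz).lt_of_ne fun hnorm => hz1 ?_
  obtain ⟨v, hv, hHv⟩ := mem_spectrum_iff_exists_mulVec_eq_smul.mp hz
  exact hH.eigenvalue_eq_one_of_norm_eq_one hv hnorm hHv

theorem one_div_gap_le (hH : IsErgodicUniform H) :
    1 / (1 - secondModulus H) ≤ 1 / Real.log (1 / lambdaH H) := by
  have hlt := hH.secondModulus_lt_one
  have hnonneg := secondModulus_nonneg H
  have hpos : 0 < lambdaH H := by unfold lambdaH; linarith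
  have hone : lambdaH H < 1 := by unfold lambdaH; linarith
  refine one_div_le_one_div_of_le (Real.log_pos ((one_lt_div hpos).mpr hone)) ?_
  refine (Real.log_le_sub_one_of_pos (one_div_pos.mpr hpos)).trans ?_
  rw [div_sub_one hpos.ne', div_le_iff₀ hpos]
  unfold lambdaH
  nlinarith

end IsErgodicUniform

section FundamentalMatrix

variable {M : ℕ} {H : Matrix (Fin M) (Fin M) ℝ}

/-- The matrix `1 - H + Π`, where `Π` is the projection onto the constants; it repairs the
singularity of `1 - H`. -/
noncomputable def regularizedLaplacian (H : Matrix (Fin M) (Fin M) ℝ) :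
    Matrix (Fin M) (Fin M) ℝ :=
  1 - H + Matrix.of fun _ _ => 1 / (M : ℝ)

/-- The fundamental matrix `(1 - H + Π)⁻¹` of a chain with uniform stationary distribution, which
solves its Poisson equation. -/
noncomputable def fundamentalMatrix (H : Matrix (Fin M) (Fin M) ℝ) : Matrix (Fin M) (Fin M) ℝ :=
  (regularizedLaplacian H)⁻¹

theorem regularizedLaplacian_mulVec (H : Matrix (Fin M) (Fin M) ℝ) (v : Fin M → ℝ) :
    regularizedLaplacian H *ᵥ v = v - H *ᵥ v + fun _ => 1 / (M : ℝ) * ∑ s, v s := by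
  rw [regularizedLaplacian, Matrix.add_mulVec, Matrix.sub_mulVec, Matrix.one_mulVec]
  simp only [Finset.mul_sum]
  rfl

theorem regularizedLaplacian_map_mulVec {v : Fin M → ℂ} (hv : ∑ s, v s = 0) :
    (regularizedLaplacian H).map (algebraMap ℝ ℂ) *ᵥ v = v - H.map (algebraMap ℝ ℂ) *ᵥ v := by
  have hmap : (regularizedLaplacian H).map (algebraMap ℝ ℂ)
      = 1 - H.map (algebraMap ℝ ℂ) + Matrix.of fun _ _ => 1 / (M : ℂ) := by
    ext r s
    by_cases hrs : r = s <;> simp [regularizedLaplacian, hrs]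
  rw [hmap, Matrix.add_mulVec, Matrix.sub_mulVec, Matrix.one_mulVec]
  ext r
  simp [Matrix.mulVec, dotProduct, ← Finset.mul_sum, hv]

theorem one_vecMul_regularizedLaplacian (hH : H ∈ doublyStochastic ℝ (Fin M)) :
    1 ᵥ* regularizedLaplacian H = 1 := by
  rw [regularizedLaplacian, Matrix.vecMul_add, Matrix.vecMul_sub, Matrix.vecMul_one,
    one_vecMul_of_mem_doublyStochastic hH, sub_self, zero_add]
  ext s
  have hM : (M : ℝ) ≠ 0 := Nat.cast_ne_zero.mpr s.pos.ne'
  simp [Matrix.vecMul, dotProduct, hM]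

theorem regularizedLaplacian_accretive (hH : H ∈ doublyStochastic ℝ (Fin M)) (v : Fin M → ℝ) :
    0 ≤ v ⬝ᵥ regularizedLaplacian H *ᵥ v := by
  have hmean : v ⬝ᵥ (fun _ => 1 / (M : ℝ) * ∑ s, v s) = 1 / (M : ℝ) * (∑ s, v s) ^ 2 := by
    rw [dotProduct, ← Finset.sum_mul]
    ring
  rw [regularizedLaplacian_mulVec, dotProduct_add, dotProduct_sub, hmean]
  have hsq : 0 ≤ 1 / (M : ℝ) * (∑ s, v s) ^ 2 := by positivity
  linarith [dotProduct_mulVec_le_of_doublyStochastic hH v]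

namespace IsErgodicUniform

theorem one_sub_secondModulus_le_norm (hH : IsErgodicUniform H) {y : ℂ}
    (hy : y ∈ spectrum ℂ ((regularizedLaplacian H).map (algebraMap ℝ ℂ))) :
    1 - secondModulus H ≤ ‖y‖ := by
  by_cases hy1 : y = 1
  · simpa [hy1] using secondModulus_nonneg H
  obtain ⟨v, hv, hAv⟩ := mem_spectrum_iff_exists_mulVec_eq_smul.mp hy
  have hcol : 1 ᵥ* (regularizedLaplacian H).map (algebraMap ℝ ℂ) = 1 := by
    ext s
    simpa [Function.comp_def, Pi.one_def] using ((algebraMap ℝ ℂ).map_vecMul _ _ s).symm.trans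
      (congrArg _ (congrFun (one_vecMul_regularizedLaplacian hH.mem_doublyStochastic) s))
  have hsum := sum_eq_zero_of_mulVec_eq_smul hcol hAv hy1
  rw [regularizedLaplacian_map_mulVec hsum] at hAv
  have hHv : H.map (algebraMap ℝ ℂ) *ᵥ v = (1 - y) • v := by
    rw [sub_smul, one_smul, ← hAv, sub_sub_cancel]
  have hy0 : y ≠ 0 := by
    rintro rfl
    refine hv (funext fun r => ?_)
    have hconst := fun s => hH.eq_of_mulVec_eq_self (by simpa using hHv) s r
    simpa [hconst, r.pos.ne'] using hsum
  have hle := norm_le_secondModulus (mem_spectrum_iff_exists_mulVec_eq_smul.mpr ⟨v, hv, hHv⟩)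
    (by simpa using hy0)
  linarith [norm_sub_norm_le 1 (1 - y), norm_one (α := ℂ), congrArg norm (sub_sub_cancel 1 y)]

theorem isUnit_regularizedLaplacian (hH : IsErgodicUniform H) :
    IsUnit (regularizedLaplacian H) := by
  rw [← spectrum.zero_notMem_iff ℝ, ← ofReal_mem_spectrum_iff]
  intro h0
  have := hH.one_sub_secondModulus_le_norm h0
  norm_num at this
  linarith [hH.secondModulus_lt_one]

theorem regularizedLaplacian_mulVec_fundamentalMatrix (hH : IsErgodicUniform H) (u : Fin M → ℝ) :
    regularizedLaplacian H *ᵥ (fundamentalMatrix H *ᵥ u) = u := by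
  rw [Matrix.mulVec_mulVec, fundamentalMatrix, Matrix.mul_nonsing_inv _
    ((Matrix.isUnit_iff_isUnit_det _).mp hH.isUnit_regularizedLaplacian), Matrix.one_mulVec]

theorem norm_le_of_mem_spectrum_fundamentalMatrix (hH : IsErgodicUniform H) {z : ℂ}
    (hz : z ∈ spectrum ℂ ((fundamentalMatrix H).map (algebraMap ℝ ℂ))) :
    ‖z‖ ≤ 1 / (1 - secondModulus H) := by
  obtain ⟨a, ha⟩ := hH.isUnit_regularizedLaplacian.map (algebraMap ℝ ℂ).mapMatrix
  have hinv : ((fundamentalMatrix H).map (algebraMap ℝ ℂ)) = ↑a⁻¹ := by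
    refine (Units.inv_eq_of_mul_eq_one_right ?_).symm
    rw [ha, fundamentalMatrix]
    exact (map_mul _ _ _).symm.trans (by rw [Matrix.mul_nonsing_inv _
      ((Matrix.isUnit_iff_isUnit_det _).mp hH.isUnit_regularizedLaplacian), map_one])
  rw [hinv, ← spectrum.inv₀_mem_iff, ha] at hz
  have hle := hH.one_sub_secondModulus_le_norm hz
  rw [norm_inv] at hle
  rw [one_div]
  have hgap := sub_pos.mpr hH.secondModulus_lt_one
  exact (le_inv_comm₀ hgap (inv_pos.mp (hgap.trans_le hle))).mp hle

theorem abs_fundamentalMatrix_le (hH : IsErgodicUniform H) (r s : Fin M) :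
    |fundamentalMatrix H r s| ≤ (2 * (M : ℝ) ^ 2 + 2) * (1 / (1 - secondModulus H)) := by
  have haccretive : ∀ u, 0 ≤ u ⬝ᵥ fundamentalMatrix H *ᵥ u := fun u => by
    have h := regularizedLaplacian_accretive hH.mem_doublyStochastic (fundamentalMatrix H *ᵥ u)
    rwa [hH.regularizedLaplacian_mulVec_fundamentalMatrix, dotProduct_comm] at h
  simpa using abs_apply_le_of_accretive haccretive
    (one_div_nonneg.mpr (sub_nonneg.mpr hH.secondModulus_lt_one.le))
    (fun z hz => hH.norm_le_of_mem_spectrum_fundamentalMatrix hz) r s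

theorem poisson_equation (hH : IsErgodicUniform H) {u : Fin M → ℝ} (hu : ∑ s, u s = 0) :
    fundamentalMatrix H *ᵥ u - H *ᵥ (fundamentalMatrix H *ᵥ u) = u := by
  have hsolve := hH.regularizedLaplacian_mulVec_fundamentalMatrix u
  have hsum : ∑ s, (fundamentalMatrix H *ᵥ u) s = 0 := by
    rw [← sum_mulVec_of_one_vecMul (one_vecMul_regularizedLaplacian hH.mem_doublyStochastic),
      hsolve, hu]
  rw [regularizedLaplacian_mulVec, hsum, mul_zero] at hsolve
  exact (add_zero _).symm.trans hsolve

end IsErgodicUniform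

end FundamentalMatrix

/-! ### Averaging over the network -/

section SymmetricMatrix

variable {ι : Type*} [Fintype ι]

theorem sum_sq_eq_sum_inner_sq (b : OrthonormalBasis ι ℝ (EuclideanSpace ℝ ι)) (v : ι → ℝ) :
    ∑ i, v i ^ 2 = ∑ i, inner ℝ (b i) (WithLp.toLp 2 v) ^ 2 := by
  simpa [EuclideanSpace.norm_sq_eq] using (b.sum_sq_norm_inner_right (WithLp.toLp 2 v)).symm

theorem inner_eigenvectorBasis_mulVec [DecidableEq ι] {A : Matrix ι ι ℝ} (hA : A.IsHermitian)
    (i : ι) (v : ι → ℝ) :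
    inner ℝ (hA.eigenvectorBasis i) (WithLp.toLp 2 (A *ᵥ v))
      = hA.eigenvalues i * inner ℝ (hA.eigenvectorBasis i) (WithLp.toLp 2 v) := by
  have htranspose : Aᵀ = A := by
    rw [← Matrix.conjTranspose_eq_transpose_of_trivial]
    exact hA
  simp only [EuclideanSpace.inner_eq_star_dotProduct, star_trivial]
  rw [dotProduct_comm, Matrix.dotProduct_mulVec, ← Matrix.mulVec_transpose, htranspose,
    hA.mulVec_eigenvectorBasis, smul_dotProduct, smul_eq_mul, dotProduct_comm]

end SymmetricMatrix

section Gossip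

variable {m : ℕ} {W : Matrix (Fin m) (Fin m) ℝ}

/-- The spectral part of the definition of a mixing matrix, without reference to a graph: this is
all that the convergence of the averaging step depends on. -/
structure IsGossipMatrix (W : Matrix (Fin m) (Fin m) ℝ) : Prop where
  symm : W.IsSymm
  null_space : LinearMap.ker (Matrix.toLin' (1 - W)) = Submodule.span ℝ {fun _ => (1 : ℝ)}
  le_one : (1 - W).PosSemidef
  neg_one_lt : (1 + W).PosDef

theorem IsMixingMatrix.isGossipMatrix {G : SimpleGraph (Fin m)} (hW : IsMixingMatrix G W) :
    IsGossipMatrix W :=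
  ⟨hW.symm, hW.null_space, hW.le_one, hW.neg_one_lt⟩

namespace IsGossipMatrix

theorem isHermitian (hW : IsGossipMatrix W) : W.IsHermitian :=
  (Matrix.conjTranspose_eq_transpose_of_trivial W).trans hW.symm

theorem mulVec_eq_self_iff (hW : IsGossipMatrix W) {v : Fin m → ℝ} :
    W *ᵥ v = v ↔ ∃ a : ℝ, v = fun _ => a := by
  have hmem : v ∈ LinearMap.ker (Matrix.toLin' (1 - W)) ↔ W *ᵥ v = v := by
    rw [LinearMap.mem_ker, Matrix.toLin'_apply, Matrix.sub_mulVec, Matrix.one_mulVec, sub_eq_zero,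
      eq_comm]
  rw [← hmem, hW.null_space, Submodule.mem_span_singleton]
  refine exists_congr fun a => ?_
  rw [eq_comm]
  simp [Pi.smul_def]

theorem mulVec_one (hW : IsGossipMatrix W) : W *ᵥ 1 = 1 :=
  hW.mulVec_eq_self_iff.mpr ⟨1, rfl⟩

theorem one_vecMul (hW : IsGossipMatrix W) : 1 ᵥ* W = 1 := by
  rw [← Matrix.mulVec_transpose, hW.symm, hW.mulVec_one]

theorem mem_Ioc_of_mem_spectrum (hW : IsGossipMatrix W) {y : ℝ} (hy : y ∈ spectrum ℝ W) :
    y ∈ Set.Ioc (-1) 1 := by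
  obtain ⟨v, hv, hWv⟩ := mem_spectrum_iff_exists_mulVec_eq_smul.mp hy
  have hpos : 0 < v ⬝ᵥ v := by
    rw [← star_trivial v]
    exact Matrix.dotProduct_star_self_pos_iff.mpr (by simpa using hv)
  have hle := hW.le_one.dotProduct_mulVec_nonneg v
  have hlt := hW.neg_one_lt.dotProduct_mulVec_pos hv
  rw [star_trivial, Matrix.sub_mulVec, Matrix.one_mulVec, hWv, dotProduct_sub, dotProduct_smul,
    smul_eq_mul] at hle
  rw [star_trivial, Matrix.add_mulVec, Matrix.one_mulVec, hWv, dotProduct_add, dotProduct_smul,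
    smul_eq_mul] at hlt
  constructor <;> nlinarith

theorem secondModulus_lt_one (hW : IsGossipMatrix W) : secondModulus W < 1 := by
  refine _root_.secondModulus_lt_one fun z hz hz1 => ?_
  have hreal : (W.map (algebraMap ℝ ℂ)).IsHermitian :=
    hW.isHermitian.map _ fun y => (Complex.conj_ofReal y).symm
  obtain ⟨y, -, rfl⟩ : z ∈ RCLike.ofReal '' Set.range hreal.eigenvalues :=
    hreal.spectrum_eq_image_range ▸ hz
  obtain ⟨hlt, hle⟩ := hW.mem_Ioc_of_mem_spectrum (ofReal_mem_spectrum_iff (y := y).mp hz)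
  rw [RCLike.norm_ofReal, abs_lt]
  exact ⟨hlt, hle.lt_of_ne fun hy1 => hz1 (by simp [hy1])⟩

theorem sum_sq_mulVec_le (hW : IsGossipMatrix W) {v : Fin m → ℝ} (hv : ∑ i, v i = 0) :
    ∑ i, (W *ᵥ v) i ^ 2 ≤ secondModulus W ^ 2 * ∑ i, v i ^ 2 := by
  have hherm := hW.isHermitian
  rw [sum_sq_eq_sum_inner_sq hherm.eigenvectorBasis (W *ᵥ v),
    sum_sq_eq_sum_inner_sq hherm.eigenvectorBasis v, Finset.mul_sum]
  refine Finset.sum_le_sum fun i _ => ?_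
  rw [inner_eigenvectorBasis_mulVec, mul_pow]
  by_cases hone : hherm.eigenvalues i = 1
  · -- the eigenvectors for the eigenvalue `1` are constant, hence orthogonal to `v`
    obtain ⟨a, ha⟩ := hW.mulVec_eq_self_iff.mp
      ((hherm.mulVec_eigenvectorBasis i).trans (by rw [hone, one_smul]))
    have horth : inner ℝ (hherm.eigenvectorBasis i) (WithLp.toLp 2 v) = 0 := by
      rw [EuclideanSpace.inner_eq_star_dotProduct, star_trivial, ha, dotProduct, ← Finset.sum_mul,
        hv, zero_mul]
    simp [horth]
  · refine mul_le_mul_of_nonneg_right (sq_le_sq.mpr ?_) (sq_nonneg _)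
    rw [abs_of_nonneg (secondModulus_nonneg W), ← Real.norm_eq_abs, ← Complex.norm_real]
    exact norm_le_secondModulus
      (ofReal_mem_spectrum_iff.mpr (hherm.eigenvalues_mem_spectrum_real i)) (by exact_mod_cast hone)

end IsGossipMatrix

end Gossip

/-! ### The uniform distribution on the sphere -/

section Sphere

open scoped Pointwise

variable {n : ℕ}

/-- The action of a linear isometry of `ℝⁿ` on the unit sphere. -/
noncomputable def sphereMap (A : Rn n ≃ₗᵢ[ℝ] Rn n) (h : UnitSphere n) : UnitSphere n :=
  ⟨A h, by simp⟩

theorem measurable_sphereMap (A : Rn n ≃ₗᵢ[ℝ] Rn n) : Measurable (sphereMap A) :=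
  (A.continuous.measurable.comp measurable_subtype_coe).subtype_mk

theorem Ioo_smul_image_preimage_sphereMap (A : Rn n ≃ₗᵢ[ℝ] Rn n) (s : Set (UnitSphere n)) :
    Set.Ioo (0 : ℝ) 1 • ((↑) '' (sphereMap A ⁻¹' s) : Set (Rn n))
      = A ⁻¹' (Set.Ioo (0 : ℝ) 1 • ((↑) '' s : Set (Rn n))) := by
  ext x
  simp only [Set.mem_smul, Set.mem_preimage]
  constructor
  · rintro ⟨t, ht, _, ⟨u, hu, rfl⟩, rfl⟩
    exact ⟨t, ht, A u, ⟨sphereMap A u, hu, rfl⟩, (A.map_smul t _).symm⟩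
  · rintro ⟨t, ht, _, ⟨u, hu, rfl⟩, hx⟩
    have hinv : sphereMap A (sphereMap A.symm u) = u := Subtype.ext (A.apply_symm_apply u)
    refine ⟨t, ht, A.symm u, ⟨sphereMap A.symm u, ?_, rfl⟩, A.injective ?_⟩
    · rwa [Set.mem_preimage, hinv]
    · rw [← hx, A.map_smul, A.apply_symm_apply]

theorem map_sphereMap_toSphere (A : Rn n ≃ₗᵢ[ℝ] Rn n) :
    (volume : Measure (Rn n)).toSphere.map (sphereMap A) = (volume : Measure (Rn n)).toSphere := by
  ext s hs
  rw [Measure.map_apply (measurable_sphereMap A) hs,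
    Measure.toSphere_apply' _ (measurable_sphereMap A hs), Measure.toSphere_apply' _ hs,
    Ioo_smul_image_preimage_sphereMap,
    A.measurePreserving.measure_preimage_emb A.toHomeomorph.measurableEmbedding]

theorem map_sphereMap_sphereUniform (A : Rn n ≃ₗᵢ[ℝ] Rn n) :
    (sphereUniform n).map (sphereMap A) = sphereUniform n := by
  rw [sphereUniform, ProbabilityTheory.cond, Measure.restrict_univ, Measure.map_smul,
    map_sphereMap_toSphere]

theorem integral_comp_sphereMap (A : Rn n ≃ₗᵢ[ℝ] Rn n) {g : UnitSphere n → ℝ}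
    (hg : Measurable g) :
    ∫ h, g (sphereMap A h) ∂sphereUniform n = ∫ h, g h ∂sphereUniform n := by
  conv_rhs => rw [← map_sphereMap_sphereUniform A]
  exact (integral_map (measurable_sphereMap A).aemeasurable hg.aestronglyMeasurable).symm

theorem measurable_sphere_apply_mul_apply (a b : Fin n) :
    Measurable fun h : UnitSphere n => (h : Rn n) a * (h : Rn n) b := by
  fun_prop

theorem integrable_apply_mul_apply_sphereUniform [IsFiniteMeasure (sphereUniform n)] (a b : Fin n) :
    Integrable (fun h : UnitSphere n => (h : Rn n) a * (h : Rn n) b) (sphereUniform n) := by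
  refine .of_bound (measurable_sphere_apply_mul_apply a b).aestronglyMeasurable 1
    (ae_of_all _ fun h => ?_)
  have hle (c : Fin n) : ‖(h : Rn n) c‖ ≤ 1 :=
    (PiLp.norm_apply_le (h : Rn n) c).trans (norm_eq_of_mem_sphere h).le
  rw [norm_mul]
  exact mul_le_one₀ (hle a) (norm_nonneg _) (hle b)

-- The reflection of the `a`-th axis changes the sign of the integrand.
theorem integral_apply_mul_apply_sphereUniform_of_ne {a b : Fin n} (hab : a ≠ b) :
    ∫ h, (h : Rn n) a * (h : Rn n) b ∂sphereUniform n = 0 := by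
  have hflip := integral_comp_sphereMap (LinearIsometryEquiv.piLpCongrRight 2 fun i : Fin n =>
    if i = a then LinearIsometryEquiv.neg ℝ else LinearIsometryEquiv.refl ℝ ℝ)
    (measurable_sphere_apply_mul_apply a b)
  simp only [sphereMap, LinearIsometryEquiv.piLpCongrRight_apply, if_true, if_neg hab.symm,
    LinearIsometryEquiv.coe_neg, LinearIsometryEquiv.coe_refl, id_eq, neg_mul,
    integral_neg] at hflip
  linarith

-- The coordinate swap makes the integral independent of `a`.
theorem integral_apply_mul_self_sphereUniform [IsProbabilityMeasure (sphereUniform n)] (a : Fin n) :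
    ∫ h, (h : Rn n) a * (h : Rn n) a ∂sphereUniform n = 1 / (n : ℝ) := by
  have hswap (b : Fin n) : ∫ h, (h : Rn n) b * (h : Rn n) b ∂sphereUniform n
      = ∫ h, (h : Rn n) a * (h : Rn n) a ∂sphereUniform n := by
    rw [← integral_comp_sphereMap (LinearIsometryEquiv.piLpCongrLeft 2 ℝ ℝ (Equiv.swap a b))
      (measurable_sphere_apply_mul_apply a a)]
    simp [sphereMap, Equiv.piCongrLeft'_apply]
  have hnorm (h : UnitSphere n) : ∑ b, (h : Rn n) b * (h : Rn n) b = 1 := by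
    have := EuclideanSpace.real_norm_sq_eq (h : Rn n)
    rw [norm_eq_of_mem_sphere h] at this
    simpa only [← pow_two, one_pow] using this.symm
  have hsum : ∑ b, ∫ h, (h : Rn n) b * (h : Rn n) b ∂sphereUniform n = 1 := by
    rw [← integral_finsetSum _ fun b _ => integrable_apply_mul_apply_sphereUniform b b]
    simp only [hnorm, integral_const, probReal_univ, smul_eq_mul, mul_one]
  rw [Finset.sum_congr rfl fun b _ => hswap b, Finset.sum_const, Finset.card_univ,
    Fintype.card_fin, nsmul_eq_mul] at hsum
  rw [eq_div_iff (Nat.cast_ne_zero.mpr a.pos.ne'), mul_comm, hsum]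

theorem integral_inner_mul_inner_sphereUniform [IsProbabilityMeasure (sphereUniform n)]
    (u v : Rn n) :
    ∫ h, inner ℝ u (h : Rn n) * inner ℝ v (h : Rn n) ∂sphereUniform n
      = inner ℝ u v / (n : ℝ) := by
  have hexpand (h : UnitSphere n) : inner ℝ u (h : Rn n) * inner ℝ v (h : Rn n)
      = ∑ a, ∑ b, u a * v b * ((h : Rn n) a * (h : Rn n) b) := by
    simp only [PiLp.inner_apply, RCLike.inner_apply, conj_trivial, Finset.sum_mul_sum]
    exact Finset.sum_congr rfl fun a _ => Finset.sum_congr rfl fun b _ => by ring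
  have hprod (a b : Fin n) := (integrable_apply_mul_apply_sphereUniform a b).const_mul (u a * v b)
  simp only [hexpand]
  rw [integral_finsetSum _ fun a _ => integrable_finsetSum _ fun b _ => hprod a b]
  simp only [integral_finsetSum _ fun b _ => hprod _ b, integral_const_mul]
  rw [PiLp.inner_apply, Finset.sum_div]
  refine Finset.sum_congr rfl fun a _ => ?_
  rw [Finset.sum_eq_single a (fun b _ hb => by
    rw [integral_apply_mul_apply_sphereUniform_of_ne hb.symm, mul_zero]) (by simp),
    integral_apply_mul_self_sphereUniform]
  simp only [RCLike.inner_apply, conj_trivial]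
  ring

theorem integral_inner_mul_inner_of_indep {Ω : Type*} {𝓖 : MeasurableSpace Ω}
    [mΩ : MeasurableSpace Ω] {P : Measure Ω} [IsProbabilityMeasure P] (h𝓖 : 𝓖 ≤ mΩ)
    {h : Ω → UnitSphere n} (hh : Measurable h) (hlaw : P.map h = sphereUniform n)
    (hindep : Indep (MeasurableSpace.comap h inferInstance) 𝓖 P) {g u : Ω → Rn n}
    (hg : Measurable[𝓖] g) (hu : Measurable[𝓖] u)
    (hprod : Integrable (fun ω => inner ℝ (g ω) (h ω : Rn n) * inner ℝ (u ω) (h ω : Rn n)) P) :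
    ∫ ω, inner ℝ (g ω) (h ω : Rn n) * inner ℝ (u ω) (h ω : Rn n) ∂P
      = (∫ ω, inner ℝ (g ω) (u ω) ∂P) / (n : ℝ) := by
  have : IsProbabilityMeasure (sphereUniform n) :=
    hlaw ▸ Measure.isProbabilityMeasure_map hh.aemeasurable
  set p : Ω → Rn n × Rn n := fun ω => (g ω, u ω)
  have hp𝓖 : Measurable[𝓖] p := Measurable.prodMk hg hu
  have hp : Measurable p := hp𝓖.mono h𝓖 le_rfl
  have hjoint : P.map (fun ω => (p ω, h ω)) = (P.map p).prod (sphereUniform n) := by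
    rw [← hlaw]
    exact (indepFun_iff_map_prod_eq_prod_map_map hp.aemeasurable hh.aemeasurable).mp
      ((IndepFun_iff_Indep _ _ _).mpr (indep_of_indep_of_le_left hindep.symm hp𝓖.comap_le))
  set F : (Rn n × Rn n) × UnitSphere n → ℝ := fun q =>
    inner ℝ q.1.1 (q.2 : Rn n) * inner ℝ q.1.2 (q.2 : Rn n)
  have hF : Measurable F := by fun_prop
  have hph := (hp.prodMk hh).aemeasurable (μ := P)
  calc ∫ ω, F (p ω, h ω) ∂P
      = ∫ q, F q ∂(P.map p).prod (sphereUniform n) := by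
        rw [← hjoint, integral_map hph hF.aestronglyMeasurable]
    _ = ∫ q, inner ℝ q.1 q.2 / (n : ℝ) ∂P.map p := by
        rw [integral_prod _ (by
          rwa [← hjoint, integrable_map_measure hF.aestronglyMeasurable hph])]
        simp only [F, integral_inner_mul_inner_sphereUniform]
    _ = _ := by
        rw [integral_div, integral_map hp.aemeasurable (by fun_prop)]

end Sphere

/-! ### Weighted sums of real sequences -/

section WeightedSums

variable {γ : ℕ → ℝ}

theorem sum_mul_sub_eq_sub_add_sum (γ u v : ℕ → ℝ) (N : ℕ) :
    ∑ k ∈ Finset.range N, γ k * (u k - v k) = γ 0 * u 0 - γ N * u N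
      + ∑ k ∈ Finset.range N, (γ k * (u (k + 1) - v k) - (γ k - γ (k + 1)) * u (k + 1)) := by
  induction N with
  | zero => simp
  | succ N ih => rw [Finset.sum_range_succ, Finset.sum_range_succ, ih]; ring

theorem abs_sum_mul_sub_le {u v : ℕ → ℝ} {Q c : ℝ} (hγ : Antitone γ) (hγ0 : ∀ k, 0 ≤ γ k)
    (hu : ∀ k, |u k| ≤ Q) (huv : ∀ k, |u (k + 1) - v k| ≤ c * γ k) (N : ℕ) :
    |∑ k ∈ Finset.range N, γ k * (u k - v k)|
      ≤ 3 * Q * γ 0 + c * ∑ k ∈ Finset.range N, γ k ^ 2 := by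
  have hweight {b : ℝ} (hb : 0 ≤ b) (k : ℕ) : |b * u k| ≤ b * Q := by
    rw [abs_mul, abs_of_nonneg hb]
    exact mul_le_mul_of_nonneg_left (hu k) hb
  have hsum : |∑ k ∈ Finset.range N, (γ k * (u (k + 1) - v k) - (γ k - γ (k + 1)) * u (k + 1))|
      ≤ ∑ k ∈ Finset.range N, (c * γ k ^ 2 + (γ k - γ (k + 1)) * Q) := by
    refine (Finset.abs_sum_le_sum_abs _ _).trans (Finset.sum_le_sum fun k _ => ?_)
    refine (abs_sub _ _).trans (add_le_add ?_ (hweight (sub_nonneg.mpr (hγ k.le_succ)) _))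
    rw [abs_mul, abs_of_nonneg (hγ0 k)]
    nlinarith [huv k, hγ0 k]
  rw [Finset.sum_add_distrib, ← Finset.mul_sum, ← Finset.sum_mul, Finset.sum_range_sub'] at hsum
  have hends : |γ 0 * u 0 - γ N * u N| ≤ γ 0 * Q + γ N * Q :=
    (abs_sub _ _).trans (add_le_add (hweight (hγ0 0) 0) (hweight (hγ0 N) N))
  have hQ : 0 ≤ Q := (abs_nonneg _).trans (hu 0)
  have hN := mul_le_mul_of_nonneg_right (hγ N.zero_le) hQ
  have hN0 := mul_nonneg (hγ0 N) hQ
  rw [sum_mul_sub_eq_sub_add_sum]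
  linarith [abs_add_le (γ 0 * u 0 - γ N * u N)
    (∑ k ∈ Finset.range N, (γ k * (u (k + 1) - v k) - (γ k - γ (k + 1)) * u (k + 1)))]

theorem sum_mul_le_of_contraction {a : ℕ → ℝ} {q K : ℝ} (hγ : Antitone γ) (hγ0 : ∀ k, 0 ≤ γ k)
    (hq : q < 1) (ha : ∀ k, 0 ≤ a k) (ha0 : a 0 = 0)
    (hrec : ∀ k, a (k + 1) ≤ q * a k + K * γ k) (N : ℕ) :
    ∑ k ∈ Finset.range N, γ k * a k
      ≤ K * (1 / (1 - q)) * ∑ k ∈ Finset.range N, γ k ^ 2 := by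
  have hshift : ∑ k ∈ Finset.range (N + 1), γ k * a k
      ≤ q * ∑ k ∈ Finset.range N, γ k * a k + K * ∑ k ∈ Finset.range N, γ k ^ 2 := by
    rw [Finset.sum_range_succ', ha0, mul_zero, add_zero, Finset.mul_sum, Finset.mul_sum,
      ← Finset.sum_add_distrib]
    refine Finset.sum_le_sum fun k _ => ?_
    calc γ (k + 1) * a (k + 1) ≤ γ k * a (k + 1) :=
          mul_le_mul_of_nonneg_right (hγ k.le_succ) (ha (k + 1))
      _ ≤ γ k * (q * a k + K * γ k) := mul_le_mul_of_nonneg_left (hrec k) (hγ0 k)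
      _ = _ := by ring
  have hlast : ∑ k ∈ Finset.range N, γ k * a k ≤ ∑ k ∈ Finset.range (N + 1), γ k * a k := by
    rw [Finset.sum_range_succ]
    exact le_add_of_nonneg_right (mul_nonneg (hγ0 N) (ha N))
  have hgap : 0 < 1 - q := by linarith
  rw [mul_one_div, div_mul_eq_mul_div, le_div_iff₀ hgap]
  linarith

theorem abs_pow_three_sub_le {a b d : ℝ} (ha : 0 ≤ a) (hb : 0 ≤ b) (hd : |b - a| ≤ d) :
    |a ^ 3 - b ^ 3| ≤ 6 * d * a ^ 2 + 6 * d ^ 3 := by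
  have hd0 : 0 ≤ d := (abs_nonneg _).trans hd
  have hbad : b ≤ a + d := by linarith [(abs_le.mp hd).2]
  have hfac : a ^ 3 - b ^ 3 = -((b - a) * (a ^ 2 + a * b + b ^ 2)) := by ring
  have hle : a ^ 2 + a * b + b ^ 2 ≤ 6 * a ^ 2 + 6 * d ^ 2 := by
    nlinarith [mul_le_mul hbad hbad hb (add_nonneg ha hd0), mul_le_mul_of_nonneg_left hbad ha,
      sq_nonneg (a - d)]
  have h0 : 0 ≤ a ^ 2 + a * b + b ^ 2 := by positivity
  rw [hfac, abs_neg, abs_mul, abs_of_nonneg h0]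
  calc |b - a| * (a ^ 2 + a * b + b ^ 2) ≤ d * (6 * a ^ 2 + 6 * d ^ 2) :=
        mul_le_mul hd hle h0 hd0
    _ = _ := by ring

-- Along the sequence the cubes form a Cauchy sequence; a positive limit would make `γ` summable.
theorem tendsto_zero_of_summable_mul_sq {a : ℕ → ℝ} {c : ℝ} (hγ0 : ∀ k, 0 ≤ γ k)
    (hγ : ¬ Summable γ) (hγ3 : Summable fun k => γ k ^ 3) (ha : ∀ k, 0 ≤ a k)
    (hsum : Summable fun k => γ k * a k ^ 2) (hinc : ∀ k, |a (k + 1) - a k| ≤ c * γ k) :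
    Tendsto a atTop (𝓝 0) := by
  have hcube (k : ℕ) : dist (a k ^ 3) (a (k + 1) ^ 3)
      ≤ 6 * c * (γ k * a k ^ 2) + 6 * c ^ 3 * γ k ^ 3 :=
    (abs_pow_three_sub_le (ha k) (ha (k + 1)) (hinc k)).trans_eq (by ring)
  obtain ⟨l, hl⟩ := cauchySeq_tendsto_of_complete (cauchySeq_of_dist_le_of_summable _ hcube
    ((hsum.mul_left _).add (hγ3.mul_left _)))
  have hl0 : 0 ≤ l := ge_of_tendsto' hl fun k => pow_nonneg (ha k) 3
  have hroot : Tendsto a atTop (𝓝 (l ^ (3⁻¹ : ℝ))) := by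
    refine (hl.rpow_const (Or.inr (by norm_num))).congr fun k => ?_
    exact_mod_cast Real.pow_rpow_inv_natCast (ha k) three_ne_zero
  rcases (Real.rpow_nonneg hl0 3⁻¹).eq_or_lt with hzero | hpos
  · rwa [← hzero] at hroot
  · set e := l ^ (3⁻¹ : ℝ) / 2
    have he : 0 < e := half_pos hpos
    refine absurd (Summable.of_norm_bounded_eventually_nat (hsum.mul_left (1 / e ^ 2)) ?_) hγ
    filter_upwards [hroot.eventually (lt_mem_nhds (half_lt_self hpos))] with k hk
    rw [Real.norm_of_nonneg (hγ0 k), one_div, ← div_eq_inv_mul, le_div_iff₀ (pow_pos he 2)]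
    exact mul_le_mul_of_nonneg_left (pow_le_pow_left₀ he.le hk.le 2) (hγ0 k)

theorem sum_mul_sq_inf'_le {a : ℕ → ℝ} (hγ0 : ∀ k, 0 ≤ γ k) (ha : ∀ k, 0 ≤ a k)
    {k : ℕ} (hk : 1 ≤ k) :
    (∑ i ∈ Finset.Icc 1 k, γ i) * (Finset.Icc 1 k).inf' (Finset.nonempty_Icc.mpr hk) a ^ 2
      ≤ ∑ i ∈ Finset.range (k + 1), γ i * a i ^ 2 := by
  rw [Finset.sum_mul]
  calc _ ≤ ∑ i ∈ Finset.Icc 1 k, γ i * a i ^ 2 :=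
        Finset.sum_le_sum fun i hi => mul_le_mul_of_nonneg_left
          (pow_le_pow_left₀ (Finset.le_inf' _ _ fun i _ => ha i) (Finset.inf'_le _ hi) 2) (hγ0 i)
    _ ≤ ∑ i ∈ Finset.range (k + 1), γ i * a i ^ 2 :=
        Finset.sum_le_sum_of_subset_of_nonneg
          (fun i hi => Finset.mem_range_succ_iff.mpr (Finset.mem_Icc.mp hi).2)
          fun i _ _ => mul_nonneg (hγ0 i) (sq_nonneg _)

end WeightedSums

section StepSize

/-- The step sizes `γ_k = (k + 1)^{-θ}`. -/
noncomputable def stepSize (θ : ℝ) (k : ℕ) : ℝ := 1 / ((k : ℝ) + 1) ^ θ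

variable {θ : ℝ}

theorem stepSize_nonneg (θ : ℝ) (k : ℕ) : 0 ≤ stepSize θ k := by
  rw [stepSize]
  positivity

theorem stepSize_zero (θ : ℝ) : stepSize θ 0 = 1 := by
  simp [stepSize]

theorem stepSize_antitone (hθ : 0 ≤ θ) : Antitone (stepSize θ) := by
  intro k l hkl
  have hle : (k : ℝ) + 1 ≤ l + 1 := by exact_mod_cast Nat.succ_le_succ hkl
  exact one_div_le_one_div_of_le (by positivity) (Real.rpow_le_rpow (by positivity) hle hθ)

theorem stepSize_pow (θ : ℝ) (d k : ℕ) : stepSize θ k ^ d = stepSize (θ * d) k := by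
  rw [stepSize, stepSize, div_pow, one_pow, Real.rpow_mul (by positivity), Real.rpow_natCast]

theorem summable_stepSize_iff : Summable (stepSize θ) ↔ 1 < θ := by
  rw [← Real.summable_one_div_nat_rpow,
    ← summable_nat_add_iff (f := fun k : ℕ => 1 / (k : ℝ) ^ θ) 1]
  push_cast
  rfl

theorem summable_stepSize_pow {d : ℕ} (hd : 1 < θ * d) : Summable fun k => stepSize θ k ^ d := by
  simp only [stepSize_pow]
  exact summable_stepSize_iff.mpr hd

theorem rpow_div_two_le_sum_stepSize (hθ : 0 ≤ θ) (hθ1 : θ ≤ 1) {k : ℕ} (hk : 1 ≤ k) :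
    (k : ℝ) ^ (1 - θ) / 2 ≤ ∑ i ∈ Finset.Icc 1 k, stepSize θ i := by
  have hk1 : (1 : ℝ) ≤ k := by exact_mod_cast hk
  have hk0 : (0 : ℝ) < k := zero_lt_one.trans_le hk1
  have hterm : ∀ i ∈ Finset.Icc 1 k, 1 / (2 * (k : ℝ) ^ θ) ≤ stepSize θ i := by
    intro i hi
    have hik : (i : ℝ) ≤ k := by exact_mod_cast (Finset.mem_Icc.mp hi).2
    refine one_div_le_one_div_of_le (by positivity) ?_
    calc ((i : ℝ) + 1) ^ θ ≤ (2 * k) ^ θ := Real.rpow_le_rpow (by positivity) (by linarith) hθ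
      _ = 2 ^ θ * (k : ℝ) ^ θ := Real.mul_rpow zero_le_two hk0.le
      _ ≤ 2 * (k : ℝ) ^ θ := by
          gcongr
          exact (Real.rpow_le_rpow_of_exponent_le one_le_two hθ1).trans_eq (Real.rpow_one 2)
  calc (k : ℝ) ^ (1 - θ) / 2 = ∑ i ∈ Finset.Icc 1 k, 1 / (2 * (k : ℝ) ^ θ) := by
        rw [Finset.sum_const, Nat.card_Icc, Nat.add_sub_cancel, nsmul_eq_mul, Real.rpow_sub hk0,
          Real.rpow_one]
        field_simp
    _ ≤ _ := Finset.sum_le_sum hterm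

theorem inf'_le_of_sum_stepSize_mul_sq_le (hθ : 0 ≤ θ) (hθ1 : θ ≤ 1) {a : ℕ → ℝ}
    (ha : ∀ k, 0 ≤ a k) {K : ℝ} (hK0 : 0 ≤ K)
    (hK : ∀ N, ∑ k ∈ Finset.range N, stepSize θ k * a k ^ 2 ≤ K ^ 2) {k : ℕ} (hk : 1 ≤ k) :
    (Finset.Icc 1 k).inf' (Finset.nonempty_Icc.mpr hk) a ≤ 2 * K / (k : ℝ) ^ ((1 - θ) / 2) := by
  set μ := (Finset.Icc 1 k).inf' (Finset.nonempty_Icc.mpr hk) a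
  set r := (k : ℝ) ^ ((1 - θ) / 2) with hr
  have hk0 : (0 : ℝ) < k := by exact_mod_cast hk
  have hrsq : (k : ℝ) ^ (1 - θ) = r ^ 2 := by
    rw [hr, ← Real.rpow_natCast, ← Real.rpow_mul hk0.le, Nat.cast_two,
      div_mul_cancel₀ _ two_ne_zero]
  have hbound : r ^ 2 / 2 * μ ^ 2 ≤ K ^ 2 := by
    rw [← hrsq]
    exact (mul_le_mul_of_nonneg_right (rpow_div_two_le_sum_stepSize hθ hθ1 hk)
      (sq_nonneg μ)).trans ((sum_mul_sq_inf'_le (stepSize_nonneg θ) ha hk).trans (hK _))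
  rw [le_div_iff₀ (Real.rpow_pos_of_pos hk0 _)]
  exact le_of_sq_le_sq (by nlinarith [sq_nonneg K]) (by positivity)

end StepSize

/-! ### Functions with bounded Lipschitz gradients -/

section SmoothLoss

open scoped NNReal

variable {E : Type*} [NormedAddCommGroup E] [InnerProductSpace ℝ E] [CompleteSpace E]
  {B L : ℝ≥0} {g : E → ℝ}

/-- A differentiable function whose gradient is bounded by `B` and Lipschitz with constant `L`. The
class contains the sample losses and is closed under averages, so that node losses and objective
belong to it as well; the constants are taken in `ℝ≥0` to dispense with sign conditions. -/
structure IsSmoothLoss (B L : ℝ≥0) (g : E → ℝ) : Prop where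
  differentiable : Differentiable ℝ g
  norm_gradient_le : ∀ x, ‖∇ g x‖ ≤ B
  lipschitzWith_gradient : LipschitzWith L (∇ g)

theorem abs_sub_le_of_norm_gradient_le (hg : Differentiable ℝ g) (hB : ∀ x, ‖∇ g x‖ ≤ B)
    (x y : E) : |g y - g x| ≤ B * ‖y - x‖ := by
  refine convex_univ.norm_image_sub_le_of_norm_fderiv_le (𝕜 := ℝ) (fun z _ => hg z)
    (fun z _ => ?_) (Set.mem_univ x) (Set.mem_univ y)
  rw [← toDual_gradient, LinearIsometryEquiv.norm_map]
  exact hB z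

theorem abs_sub_sub_inner_gradient_le (hg : Differentiable ℝ g) (hL : LipschitzWith L (∇ g))
    (x y : E) : |g y - g x - inner ℝ (∇ g x) (y - x)| ≤ L * ‖y - x‖ ^ 2 := by
  have hball : ∀ z ∈ Metric.closedBall x ‖y - x‖,
      ‖fderiv ℝ g z - fderiv ℝ g x‖ ≤ L * ‖y - x‖ := by
    intro z hz
    rw [← toDual_gradient, ← toDual_gradient, ← map_sub, LinearIsometryEquiv.norm_map]
    exact (hL.norm_sub_le z x).trans
      (mul_le_mul_of_nonneg_left (mem_closedBall_iff_norm.mp hz) L.coe_nonneg)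
  have h := (convex_closedBall x ‖y - x‖).norm_image_sub_le_of_norm_fderiv_le' (𝕜 := ℝ)
    (fun z _ => hg z) hball (Metric.mem_closedBall_self (norm_nonneg _))
    (mem_closedBall_iff_norm.mpr le_rfl)
  rwa [Real.norm_eq_abs, mul_assoc, ← pow_two, ← inner_gradient_left] at h

theorem norm_average_le {F : Type*} [NormedAddCommGroup F] [NormedSpace ℝ F] {N : ℕ}
    {v : Fin N → F} {K : ℝ} (hK : 0 ≤ K) (hv : ∀ i, ‖v i‖ ≤ K) :
    ‖(1 / (N : ℝ)) • ∑ i, v i‖ ≤ K := by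
  rw [norm_smul, Real.norm_of_nonneg (by positivity), one_div_mul_eq_div]
  refine div_le_of_le_mul₀ N.cast_nonneg hK ?_
  simpa [mul_comm] using norm_sum_le_of_le Finset.univ fun i _ => hv i

theorem gradient_average {N : ℕ} {g : Fin N → E → ℝ} (hg : ∀ i, Differentiable ℝ (g i)) (x : E) :
    ∇ (fun y => (1 / (N : ℝ)) * ∑ i, g i y) x = (1 / (N : ℝ)) • ∑ i, ∇ (g i) x := by
  refine HasGradientAt.gradient ?_
  rw [hasGradientAt_iff_hasFDerivAt]
  refine ((HasFDerivAt.fun_sum (u := Finset.univ) fun i _ =>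
    (hg i x).hasFDerivAt).const_mul _).congr_fderiv ?_
  simp only [map_smul, map_sum, toDual_gradient]

theorem IsSmoothLoss.average {N : ℕ} {g : Fin N → E → ℝ} (hg : ∀ i, IsSmoothLoss B L (g i)) :
    IsSmoothLoss B L fun y => (1 / (N : ℝ)) * ∑ i, g i y := by
  have hgrad := gradient_average fun i => (hg i).differentiable
  refine ⟨(Differentiable.fun_sum fun i _ => (hg i).differentiable).const_mul _, fun x => ?_,
    LipschitzWith.of_dist_le_mul fun x y => ?_⟩
  · rw [hgrad]
    exact norm_average_le B.coe_nonneg fun i => (hg i).norm_gradient_le x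
  · rw [dist_eq_norm, hgrad, hgrad, ← smul_sub, ← Finset.sum_sub_distrib]
    exact norm_average_le (by positivity) fun i =>
      ((hg i).lipschitzWith_gradient.dist_le_mul x y).trans' (dist_eq_norm _ _).ge

theorem IsSmoothLoss.mul_inner_gradient_le (hg : IsSmoothLoss B L g) {v : E} {K : ℝ}
    (hv : ‖v‖ ≤ K) (c : ℝ) (y : E) :
    c * inner ℝ (∇ g y) v ≤ g y - g (y - c • v) + L * K ^ 2 * c ^ 2 := by
  have htaylor := abs_sub_sub_inner_gradient_le hg.differentiable hg.lipschitzWith_gradient y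
    (y - c • v)
  rw [sub_sub_cancel_left, inner_neg_right, real_inner_smul_right, norm_neg, norm_smul, mul_pow,
    Real.norm_eq_abs, sq_abs] at htaylor
  have hsq : L * (c ^ 2 * ‖v‖ ^ 2) ≤ L * (c ^ 2 * K ^ 2) := by gcongr
  linarith [(abs_le.mp htaylor).2]

theorem IsSmoothLoss.sum_mul_inner_gradient_le (hg : IsSmoothLoss B L g) {y v : ℕ → E}
    {γ : ℕ → ℝ} {K : ℝ} (hy : ∀ k, y (k + 1) = y k - γ k • v k) (hv : ∀ k, ‖v k‖ ≤ K) (N : ℕ) :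
    ∑ k ∈ Finset.range N, γ k * inner ℝ (∇ g (y k)) (v k)
      ≤ g (y 0) - g (y N) + L * K ^ 2 * ∑ k ∈ Finset.range N, γ k ^ 2 := by
  rw [← Finset.sum_range_sub' fun k => g (y k), Finset.mul_sum, ← Finset.sum_add_distrib]
  refine Finset.sum_le_sum fun k _ => ?_
  rw [hy]
  exact hg.mul_inner_gradient_le (hv k) (γ k) (y k)

end SmoothLoss

theorem LossAssumptions.isSmoothLoss {n m M : ℕ} {B L : ℝ} {f : Fin m → Fin M → Rn n → ℝ}
    (hf : LossAssumptions B L f) (i : Fin m) (s : Fin M) :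
    IsSmoothLoss B.toNNReal L.toNNReal (f i s) where
  differentiable := hf.differentiable i s
  norm_gradient_le x := (hf.gradient_bound i s x).trans B.le_coe_toNNReal
  lipschitzWith_gradient := LipschitzWith.of_dist_le' fun x y => by
    simpa only [dist_eq_norm] using hf.gradient_lipschitz i s x y

section TwoPoint

open scoped NNReal

variable {n : ℕ} {B L : ℝ≥0} {g : Rn n → ℝ} {δ : ℝ}

theorem norm_twoPoint_le (hg : Differentiable ℝ g) (hB : ∀ x, ‖∇ g x‖ ≤ B) (hδ : 0 < δ)
    (h : UnitSphere n) (x : Rn n) : ‖twoPoint g δ h x‖ ≤ n * B := by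
  have hh : ‖(h : Rn n)‖ = 1 := norm_eq_of_mem_sphere h
  have hsub := abs_sub_le_of_norm_gradient_le hg hB x (x + δ • (h : Rn n))
  rw [add_sub_cancel_left, norm_smul, hh, mul_one, Real.norm_of_nonneg hδ.le] at hsub
  rw [twoPoint, norm_smul, hh, mul_one, Real.norm_eq_abs, abs_div, abs_mul, abs_of_pos hδ,
    Nat.abs_cast, div_le_iff₀ hδ, mul_assoc]
  exact mul_le_mul_of_nonneg_left hsub n.cast_nonneg

theorem mul_inner_mul_inner_sub_le_inner_twoPoint (hg : Differentiable ℝ g)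
    (hL : LipschitzWith L (∇ g)) (hδ : 0 < δ) (h : UnitSphere n) (x : Rn n) {u : Rn n}
    (hu : ‖u‖ ≤ B) :
    n * (inner ℝ (∇ g x) (h : Rn n) * inner ℝ u (h : Rn n)) - B * n * L * δ
      ≤ inner ℝ u (twoPoint g δ h x) := by
  have hh : ‖(h : Rn n)‖ = 1 := norm_eq_of_mem_sphere h
  have htaylor := abs_sub_sub_inner_gradient_le hg hL x (x + δ • (h : Rn n))
  rw [add_sub_cancel_left, norm_smul, hh, mul_one, Real.norm_eq_abs, sq_abs,
    real_inner_smul_right] at htaylor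
  set r := g (x + δ • (h : Rn n)) - g x - δ * inner ℝ (∇ g x) (h : Rn n) with hr
  have hsplit : inner ℝ u (twoPoint g δ h x)
      = n * (inner ℝ (∇ g x) (h : Rn n) * inner ℝ u (h : Rn n))
        + n * (r / δ * inner ℝ u (h : Rn n)) := by
    rw [twoPoint, real_inner_smul_right, hr]
    field_simp
    ring
  have hrem : |r / δ * inner ℝ u (h : Rn n)| ≤ L * δ * B := by
    rw [abs_mul, abs_div, abs_of_pos hδ]
    refine mul_le_mul ?_ ?_ (abs_nonneg _) (by positivity)
    · rwa [div_le_iff₀ hδ, mul_assoc, ← pow_two]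
    · simpa only [hh, mul_one] using (abs_real_inner_le_norm u (h : Rn n)).trans
        (mul_le_mul_of_nonneg_right hu (norm_nonneg _))
  have := mul_le_mul_of_nonneg_left (neg_le_of_abs_le hrem) (n.cast_nonneg (α := ℝ))
  rw [hsplit]
  linarith

end TwoPoint

section Objective

open scoped NNReal

variable {n m M : ℕ} {B L : ℝ≥0} {f : Fin m → Fin M → Rn n → ℝ}

theorem isSmoothLoss_nodeLoss (hf : ∀ i s, IsSmoothLoss B L (f i s)) (i : Fin m) :
    IsSmoothLoss B L (nodeLoss f i) :=
  .average (hf i)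

theorem isSmoothLoss_objective (hf : ∀ i s, IsSmoothLoss B L (f i s)) :
    IsSmoothLoss B L (objective f) :=
  .average (isSmoothLoss_nodeLoss hf)

/-- The deviation of the gradient of a sample loss from the gradient of the node loss, in the
direction of the gradient of the objective: the part of the error that is due to the sampling. -/
noncomputable def sampleDeviation (f : Fin m → Fin M → Rn n → ℝ) (i : Fin m) (s : Fin M)
    (y : Rn n) : ℝ :=
  inner ℝ (∇ (objective f) y) (∇ (f i s) y - ∇ (nodeLoss f i) y)

theorem sum_sampleDeviation (hf : ∀ i s, IsSmoothLoss B L (f i s)) (i : Fin m) (y : Rn n) :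
    ∑ s, sampleDeviation f i s y = 0 := by
  have hgrad : ∇ (nodeLoss f i) y = (1 / (M : ℝ)) • ∑ s, ∇ (f i s) y :=
    gradient_average (fun s => (hf i s).differentiable) y
  rcases M.eq_zero_or_pos with rfl | hM
  · exact Finset.sum_empty
  · have hM' : (M : ℝ) ≠ 0 := Nat.cast_ne_zero.mpr hM.ne'
    simp only [sampleDeviation]
    rw [← inner_sum, Finset.sum_sub_distrib, hgrad, Finset.sum_const, Finset.card_univ,
      Fintype.card_fin, ← Nat.cast_smul_eq_nsmul ℝ, smul_smul, mul_one_div_cancel hM', one_smul,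
      sub_self, inner_zero_right]

theorem norm_gradient_sub_gradient_nodeLoss_le (hf : ∀ i s, IsSmoothLoss B L (f i s)) (i : Fin m)
    (s : Fin M) (y : Rn n) : ‖∇ (f i s) y - ∇ (nodeLoss f i) y‖ ≤ B + B :=
  norm_sub_le_of_le ((hf i s).norm_gradient_le y) ((isSmoothLoss_nodeLoss hf i).norm_gradient_le y)

theorem abs_sampleDeviation_le (hf : ∀ i s, IsSmoothLoss B L (f i s)) (i : Fin m) (s : Fin M)
    (y : Rn n) : |sampleDeviation f i s y| ≤ 2 * (B : ℝ) ^ 2 :=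
  calc |sampleDeviation f i s y|
      ≤ ‖∇ (objective f) y‖ * ‖∇ (f i s) y - ∇ (nodeLoss f i) y‖ := abs_real_inner_le_norm _ _
    _ ≤ B * (B + B) := mul_le_mul ((isSmoothLoss_objective hf).norm_gradient_le y)
        (norm_gradient_sub_gradient_nodeLoss_le hf i s y) (norm_nonneg _) B.coe_nonneg
    _ = _ := by ring

theorem abs_inner_sub_inner_le {E : Type*} [NormedAddCommGroup E] [InnerProductSpace ℝ E]
    (u v u' v' : E) :
    |inner ℝ u v - inner ℝ u' v'| ≤ ‖u - u'‖ * ‖v‖ + ‖u'‖ * ‖v - v'‖ := by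
  have hsplit : inner ℝ u v - inner ℝ u' v' = inner ℝ (u - u') v + inner ℝ u' (v - v') := by
    rw [inner_sub_left, inner_sub_right]
    ring
  rw [hsplit]
  exact (abs_add_le _ _).trans
    (add_le_add (abs_real_inner_le_norm _ _) (abs_real_inner_le_norm _ _))

theorem lipschitzWith_sampleDeviation (hf : ∀ i s, IsSmoothLoss B L (f i s)) (i : Fin m)
    (s : Fin M) : LipschitzWith (4 * B * L) (sampleDeviation f i s) := by
  have hF := isSmoothLoss_objective hf
  refine LipschitzWith.of_dist_le_mul fun y z => ?_
  have hdiff : ‖(∇ (f i s) y - ∇ (nodeLoss f i) y) - (∇ (f i s) z - ∇ (nodeLoss f i) z)‖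
      ≤ L * ‖y - z‖ + L * ‖y - z‖ := by
    rw [sub_sub_sub_comm]
    exact norm_sub_le_of_le ((hf i s).lipschitzWith_gradient.norm_sub_le y z)
      ((isSmoothLoss_nodeLoss hf i).lipschitzWith_gradient.norm_sub_le y z)
  rw [Real.dist_eq, dist_eq_norm]
  calc _ ≤ ‖∇ (objective f) y - ∇ (objective f) z‖ * ‖∇ (f i s) y - ∇ (nodeLoss f i) y‖
        + ‖∇ (objective f) z‖
          * ‖(∇ (f i s) y - ∇ (nodeLoss f i) y) - (∇ (f i s) z - ∇ (nodeLoss f i) z)‖ :=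
        abs_inner_sub_inner_le _ _ _ _
    _ ≤ L * ‖y - z‖ * (B + B) + B * (L * ‖y - z‖ + L * ‖y - z‖) := by
        gcongr
        · exact hF.lipschitzWith_gradient.norm_sub_le y z
        · exact norm_gradient_sub_gradient_nodeLoss_le hf i s y
        · exact hF.norm_gradient_le z
    _ = ((4 * B * L : ℝ≥0) : ℝ) * ‖y - z‖ := by
        push_cast
        ring

/-- The error of the two-point estimator that is due to the choice of the direction `h`, in the
direction of `u`: the difference between `⟪u, n ⟪g, h⟫ h⟫` and its mean `⟪u, g⟫`. -/
noncomputable def directionDeviation (g u : Rn n) (h : UnitSphere n) : ℝ :=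
  n * (inner ℝ g (h : Rn n) * inner ℝ u (h : Rn n)) - inner ℝ u g

theorem abs_inner_mul_inner_le {g u : Rn n} (hg : ‖g‖ ≤ B) (hu : ‖u‖ ≤ B) (h : UnitSphere n) :
    |inner ℝ g (h : Rn n) * inner ℝ u (h : Rn n)| ≤ (B : ℝ) ^ 2 := by
  have hle {w : Rn n} (hw : ‖w‖ ≤ B) : |inner ℝ w (h : Rn n)| ≤ B := by
    simpa only [norm_eq_of_mem_sphere, mul_one] using (abs_real_inner_le_norm w (h : Rn n)).trans
      (mul_le_mul_of_nonneg_right hw (norm_nonneg _))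
  rw [abs_mul, pow_two]
  exact mul_le_mul (hle hg) (hle hu) (abs_nonneg _) B.coe_nonneg

theorem inner_gradient_nodeLoss_add_sub_le (hf : ∀ i s, IsSmoothLoss B L (f i s)) {δ : ℝ}
    (hδ : 0 < δ) (i : Fin m) (s : Fin M) (h : UnitSphere n) (x y : Rn n) :
    inner ℝ (∇ (objective f) y) (∇ (nodeLoss f i) y) + sampleDeviation f i s y
        + directionDeviation (∇ (f i s) x) (∇ (objective f) y) h
        - B * L * ‖x - y‖ - B * n * L * δ
      ≤ inner ℝ (∇ (objective f) y) (twoPoint (f i s) δ h x) := by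
  have hF := (isSmoothLoss_objective hf).norm_gradient_le y
  have hmove : |inner ℝ (∇ (objective f) y) (∇ (f i s) x - ∇ (f i s) y)| ≤ B * (L * ‖x - y‖) :=
    (abs_real_inner_le_norm _ _).trans (mul_le_mul hF
      ((hf i s).lipschitzWith_gradient.norm_sub_le x y) (norm_nonneg _) B.coe_nonneg)
  have htwo := mul_inner_mul_inner_sub_le_inner_twoPoint (hf i s).differentiable
    (hf i s).lipschitzWith_gradient hδ h x hF
  have hneg := neg_le_of_abs_le hmove
  simp only [sampleDeviation, directionDeviation, inner_sub_right] at hneg ⊢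
  linarith

theorem sq_norm_gradient_objective_add_sub_le (hf : ∀ i s, IsSmoothLoss B L (f i s)) (hm : 0 < m)
    {δ : ℝ} (hδ : 0 < δ) (s : Fin m → Fin M) (h : Fin m → UnitSphere n) (x : Fin m → Rn n)
    {y : Rn n} {c : ℝ} (hc : ∀ i, ‖x i - y‖ ≤ c) :
    ‖∇ (objective f) y‖ ^ 2 + (1 / (m : ℝ)) * ∑ i, (sampleDeviation f i (s i) y
          + directionDeviation (∇ (f i (s i)) (x i)) (∇ (objective f) y) (h i))
        - B * L * c - B * n * L * δ
      ≤ inner ℝ (∇ (objective f) y)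
          (nodeAverage fun i => twoPoint (f i (s i)) δ (h i) (x i)) := by
  have hm' : (m : ℝ) ≠ 0 := Nat.cast_ne_zero.mpr hm.ne'
  have hgrad : ∇ (objective f) y = (1 / (m : ℝ)) • ∑ i, ∇ (nodeLoss f i) y :=
    gradient_average (fun i => (isSmoothLoss_nodeLoss hf i).differentiable) y
  have hself : ‖∇ (objective f) y‖ ^ 2
      = (1 / (m : ℝ)) * ∑ i, inner ℝ (∇ (objective f) y) (∇ (nodeLoss f i) y) := by
    rw [← inner_sum, ← real_inner_smul_right, ← hgrad, real_inner_self_eq_norm_sq]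
  have hconst : B * L * c + B * n * L * δ
      = (1 / (m : ℝ)) * ∑ _i : Fin m, (B * L * c + B * n * L * δ) := by
    rw [Finset.sum_const, Finset.card_univ, Fintype.card_fin, nsmul_eq_mul, ← mul_assoc,
      one_div_mul_cancel hm', one_mul]
  rw [hself, sub_sub, hconst, nodeAverage, real_inner_smul_right, inner_sum, ← mul_add, ← mul_sub,
    ← Finset.sum_add_distrib, ← Finset.sum_sub_distrib]
  refine mul_le_mul_of_nonneg_left (Finset.sum_le_sum fun i _ => ?_) (by positivity)
  have hnear : B * L * ‖x i - y‖ ≤ B * L * c := by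
    gcongr
    exact hc i
  linarith [inner_gradient_nodeLoss_add_sub_le hf hδ i (s i) (h i) (x i) y]

end Objective

/-! ### Consensus and descent along a path -/

section Consensus

variable {n m : ℕ} {W : Matrix (Fin m) (Fin m) ℝ} {K : ℝ}

/-- The distance of the local variables from their average, as an `ℓ²` norm over the nodes: this is
the norm in which averaging with `W` contracts. -/
noncomputable def dispersion (x : Fin m → Rn n) : ℝ :=
  ‖(WithLp.toLp 2 fun i => x i - nodeAverage x : PiLp 2 fun _ : Fin m => Rn n)‖

theorem dispersion_nonneg (x : Fin m → Rn n) : 0 ≤ dispersion x :=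
  norm_nonneg _

theorem norm_sub_nodeAverage_le_dispersion (x : Fin m → Rn n) (i : Fin m) :
    ‖x i - nodeAverage x‖ ≤ dispersion x :=
  PiLp.norm_apply_le (WithLp.toLp 2 fun i => x i - nodeAverage x : PiLp 2 fun _ : Fin m => Rn n) i

theorem nodeAverage_const (hm : 0 < m) (x : Rn n) : nodeAverage (fun _ : Fin m => x) = x := by
  have hm' : (m : ℝ) ≠ 0 := Nat.cast_ne_zero.mpr hm.ne'
  rw [nodeAverage, Finset.sum_const, Finset.card_univ, Fintype.card_fin,
    ← Nat.cast_smul_eq_nsmul ℝ, smul_smul, one_div_mul_cancel hm', one_smul]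

theorem dispersion_const (x : Rn n) : dispersion (fun _ : Fin m => x) = 0 := by
  refine norm_eq_zero.mpr (PiLp.ext fun i => ?_)
  exact sub_eq_zero.mpr (nodeAverage_const (Fin.pos i) x).symm

theorem sum_sub_nodeAverage (x : Fin m → Rn n) : ∑ i, (x i - nodeAverage x) = 0 := by
  rcases m.eq_zero_or_pos with rfl | hm
  · exact Finset.sum_empty
  · have hm' : (m : ℝ) ≠ 0 := Nat.cast_ne_zero.mpr hm.ne'
    rw [Finset.sum_sub_distrib, nodeAverage, Finset.sum_const, Finset.card_univ, Fintype.card_fin,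
      ← Nat.cast_smul_eq_nsmul ℝ, smul_smul, mul_one_div_cancel hm', one_smul, sub_self]

theorem norm_toLp_le_card_mul {e : Fin m → Rn n} (he : ∀ i, ‖e i‖ ≤ K) :
    ‖(WithLp.toLp 2 e : PiLp 2 fun _ : Fin m => Rn n)‖ ≤ m * K := by
  rcases m.eq_zero_or_pos with rfl | hm
  · simp [PiLp.norm_eq_of_L2]
  · have hK : 0 ≤ K := (norm_nonneg _).trans (he ⟨0, hm⟩)
    refine (sq_le_sq₀ (norm_nonneg _) (by positivity)).mp ?_
    have hm_sq : (m : ℝ) ≤ (m : ℝ) ^ 2 := by exact_mod_cast Nat.le_self_pow two_ne_zero m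
    rw [PiLp.norm_sq_eq_of_L2, mul_pow]
    calc ∑ i, ‖e i‖ ^ 2 ≤ ∑ _i : Fin m, K ^ 2 :=
          Finset.sum_le_sum fun i _ => pow_le_pow_left₀ (norm_nonneg _) (he i) 2
      _ = m * K ^ 2 := by simp
      _ ≤ (m : ℝ) ^ 2 * K ^ 2 := mul_le_mul_of_nonneg_right hm_sq (sq_nonneg K)

theorem dispersion_le {x : Fin m → Rn n} (hK : 0 ≤ K) (hx : ∀ i, ‖x i‖ ≤ K) :
    dispersion x ≤ 2 * m * K := by
  refine (norm_toLp_le_card_mul fun i =>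
    norm_sub_le_of_le (hx i) (norm_average_le hK hx)).trans_eq ?_
  ring

namespace IsGossipMatrix

theorem nodeAverage_sum_smul (hW : IsGossipMatrix W) (x : Fin m → Rn n) :
    nodeAverage (fun i => ∑ l, W i l • x l) = nodeAverage x := by
  have hcol (l : Fin m) : ∑ i, W i l = 1 := by
    simpa [Matrix.vecMul, dotProduct] using congrFun hW.one_vecMul l
  rw [nodeAverage, nodeAverage, Finset.sum_comm]
  simp only [← Finset.sum_smul, hcol, one_smul]

theorem nodeAverage_step (hW : IsGossipMatrix W) (x d : Fin m → Rn n) (c : ℝ) :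
    nodeAverage (fun i => ∑ l, W i l • x l - c • d i) = nodeAverage x - c • nodeAverage d := by
  rw [← hW.nodeAverage_sum_smul x]
  simp only [nodeAverage, Finset.sum_sub_distrib, ← Finset.smul_sum, smul_sub,
    smul_comm c (1 / (m : ℝ))]

theorem norm_toLp_sum_smul_le (hW : IsGossipMatrix W) {e : Fin m → Rn n} (he : ∑ i, e i = 0) :
    ‖(WithLp.toLp 2 fun i => ∑ l, W i l • e l : PiLp 2 fun _ : Fin m => Rn n)‖
      ≤ secondModulus W * ‖(WithLp.toLp 2 e : PiLp 2 fun _ : Fin m => Rn n)‖ := by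
  refine (sq_le_sq₀ (norm_nonneg _) (mul_nonneg (secondModulus_nonneg W) (norm_nonneg _))).mp ?_
  rw [mul_pow, PiLp.norm_sq_eq_of_L2, PiLp.norm_sq_eq_of_L2]
  simp only [EuclideanSpace.norm_sq_eq, Real.norm_eq_abs, sq_abs]
  rw [Finset.sum_comm, Finset.sum_comm (f := fun i a => e i a ^ 2), Finset.mul_sum]
  refine Finset.sum_le_sum fun a _ => ?_
  have hcoord : ∑ i, e i a = 0 := by simpa using congrArg (fun v : Rn n => v a) he
  simpa [Matrix.mulVec, dotProduct] using hW.sum_sq_mulVec_le hcoord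

theorem dispersion_step_le (hW : IsGossipMatrix W) (x : Fin m → Rn n) {d : Fin m → Rn n} {c : ℝ}
    (hc : 0 ≤ c) (hK : 0 ≤ K) (hd : ∀ i, ‖d i‖ ≤ K) :
    dispersion (fun i => ∑ l, W i l • x l - c • d i)
      ≤ secondModulus W * dispersion x + 2 * m * K * c := by
  have hrow (i : Fin m) : ∑ l, W i l = 1 := by
    simpa [Matrix.mulVec, dotProduct] using congrFun hW.mulVec_one i
  have hsplit : (WithLp.toLp 2 fun i => (∑ l, W i l • x l - c • d i)
      - nodeAverage (fun i => ∑ l, W i l • x l - c • d i) : PiLp 2 fun _ : Fin m => Rn n)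
      = (WithLp.toLp 2 fun i => ∑ l, W i l • (x l - nodeAverage x) : PiLp 2 fun _ : Fin m => Rn n)
        - c • (WithLp.toLp 2 fun i => d i - nodeAverage d : PiLp 2 fun _ : Fin m => Rn n) := by
    refine PiLp.ext fun i => ?_
    simp only [PiLp.sub_apply, PiLp.smul_apply]
    rw [hW.nodeAverage_step]
    simp only [smul_sub, Finset.sum_sub_distrib, ← Finset.sum_smul, hrow, one_smul]
    abel
  rw [dispersion, hsplit]
  refine (norm_sub_le _ _).trans
    (add_le_add (hW.norm_toLp_sum_smul_le (sum_sub_nodeAverage x)) ?_)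
  rw [norm_smul, Real.norm_of_nonneg hc, mul_comm]
  exact mul_le_mul_of_nonneg_right (dispersion_le hK hd) hc

theorem sum_mul_dispersion_le (hW : IsGossipMatrix W) {x d : ℕ → Fin m → Rn n} {γ : ℕ → ℝ}
    (hγ : Antitone γ) (hγ0 : ∀ k, 0 ≤ γ k) (hK : 0 ≤ K) (hd : ∀ k i, ‖d k i‖ ≤ K)
    (hx0 : dispersion (x 0) = 0)
    (hx : ∀ k, x (k + 1) = fun i => ∑ l, W i l • x k l - γ k • d k i) (N : ℕ) :
    ∑ k ∈ Finset.range N, γ k * dispersion (x k)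
      ≤ 2 * m * K * (1 / (1 - secondModulus W)) * ∑ k ∈ Finset.range N, γ k ^ 2 :=
  sum_mul_le_of_contraction hγ hγ0 hW.secondModulus_lt_one (fun k => dispersion_nonneg (x k)) hx0
    (fun k => hx k ▸ hW.dispersion_step_le (x k) (hγ0 k) hK (hd k)) N

end IsGossipMatrix

end Consensus

section Path

open scoped NNReal

variable {n m M : ℕ} {W : Matrix (Fin m) (Fin m) ℝ} {B L : ℝ≥0}
  {f : Fin m → Fin M → Rn n → ℝ} {γ δ : ℕ → ℝ} {x₀ : Rn n}

theorem norm_nodeAverage_zoDMGD_succ_sub_le (hW : IsGossipMatrix W)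
    (hf : ∀ i s, IsSmoothLoss B L (f i s)) (hγ : ∀ k, 0 ≤ γ k) (hδ : ∀ k, 0 < δ k)
    (j : Fin m → ℕ → Fin M) (h : Fin m → ℕ → UnitSphere n) (k : ℕ) :
    ‖nodeAverage (zoDMGD W f γ δ x₀ j h (k + 1)) - nodeAverage (zoDMGD W f γ δ x₀ j h k)‖
      ≤ n * B * γ k := by
  have hstep : nodeAverage (zoDMGD W f γ δ x₀ j h (k + 1)) = _ := hW.nodeAverage_step _ _ _
  rw [hstep, sub_sub_cancel_left, norm_neg, norm_smul, Real.norm_of_nonneg (hγ k), mul_comm]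
  exact mul_le_mul_of_nonneg_right (norm_average_le (by positivity) fun i =>
    norm_twoPoint_le (hf _ _).differentiable (hf _ _).norm_gradient_le (hδ k) _ _) (hγ k)

theorem sum_mul_dispersion_zoDMGD_le (hW : IsGossipMatrix W)
    (hf : ∀ i s, IsSmoothLoss B L (f i s)) (hγ : Antitone γ) (hγ0 : ∀ k, 0 ≤ γ k)
    (hδ : ∀ k, 0 < δ k) (j : Fin m → ℕ → Fin M) (h : Fin m → ℕ → UnitSphere n) (N : ℕ) :
    ∑ k ∈ Finset.range N, γ k * dispersion (zoDMGD W f γ δ x₀ j h k)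
      ≤ 2 * m * (n * B) * (1 / (1 - secondModulus W)) * ∑ k ∈ Finset.range N, γ k ^ 2 :=
  hW.sum_mul_dispersion_le (x := zoDMGD W f γ δ x₀ j h)
    (d := fun k i => twoPoint (f i (j i k)) (δ k) (h i k) (zoDMGD W f γ δ x₀ j h k i)) hγ hγ0
    (by positivity)
    (fun k i => norm_twoPoint_le (hf _ _).differentiable (hf _ _).norm_gradient_le (hδ k) _ _)
    (dispersion_const x₀) (fun _ => rfl) N

theorem sum_mul_sq_norm_gradient_nodeAverage_add_le (hm : 0 < m) (hW : IsGossipMatrix W)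
    (hf : ∀ i s, IsSmoothLoss B L (f i s)) (hγ : Antitone γ) (hγ0 : ∀ k, 0 ≤ γ k)
    (hδ : ∀ k, 0 < δ k) {D : ℝ} (hD : ∀ x, objective f x₀ - objective f x ≤ D)
    (j : Fin m → ℕ → Fin M) (h : Fin m → ℕ → UnitSphere n) (N : ℕ) :
    ∑ k ∈ Finset.range N, γ k * (‖∇ (objective f) (nodeAverage (zoDMGD W f γ δ x₀ j h k))‖ ^ 2
        + (1 / (m : ℝ)) * ∑ i, (sampleDeviation f i (j i k) (nodeAverage (zoDMGD W f γ δ x₀ j h k))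
          + directionDeviation (∇ (f i (j i k)) (zoDMGD W f γ δ x₀ j h k i))
              (∇ (objective f) (nodeAverage (zoDMGD W f γ δ x₀ j h k))) (h i k)))
      ≤ D + (L * (n * B) ^ 2 + B * L * (2 * m * (n * B) * (1 / (1 - secondModulus W))))
            * ∑ k ∈ Finset.range N, γ k ^ 2
          + B * n * L * ∑ k ∈ Finset.range N, γ k * δ k := by
  set x := zoDMGD W f γ δ x₀ j h
  set y := fun k => nodeAverage (x k)
  have hdescent := (isSmoothLoss_objective hf).sum_mul_inner_gradient_le (y := y) (K := n * B)
    (fun k => hW.nodeAverage_step _ _ _) (fun k => norm_average_le (by positivity) fun i =>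
      norm_twoPoint_le (hf i (j i k)).differentiable (hf _ _).norm_gradient_le (hδ k) (h i k)
        (x k i)) N
  have hestimate : ∀ k ∈ Finset.range N, _ := fun k _ => mul_le_mul_of_nonneg_left
    (sq_norm_gradient_objective_add_sub_le hf hm (hδ k) (j · k) (h · k) (x k)
      (norm_sub_nodeAverage_le_dispersion (x k))) (hγ0 k)
  have hconsensus := mul_le_mul_of_nonneg_left
    (sum_mul_dispersion_zoDMGD_le (x₀ := x₀) hW hf hγ hγ0 hδ j h N)
    (by positivity : (0 : ℝ) ≤ B * L)
  have hy0 : y 0 = x₀ := nodeAverage_const hm x₀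
  have hsum := (Finset.sum_le_sum hestimate).trans hdescent
  simp only [mul_sub, Finset.sum_sub_distrib, mul_left_comm (γ _), ← Finset.mul_sum] at hsum
  rw [hy0] at hsum
  linarith [hD (y N)]

end Path

/-! ### Sums along a Markov chain -/

theorem measurable_apply_index {Ω ι E F : Type*} [MeasurableSpace Ω] [MeasurableSpace ι]
    [Countable ι] [MeasurableSingletonClass ι] [MeasurableSpace E] [MeasurableSpace F]
    {g : ι → E → F} (hg : ∀ s, Measurable (g s)) {J : Ω → ι} (hJ : Measurable J) {Y : Ω → E}
    (hY : Measurable Y) : Measurable fun ω => g (J ω) (Y ω) :=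
  (measurable_from_prod_countable_left (f := fun p : E × ι => g p.2 p.1) hg).comp (hY.prodMk hJ)

theorem abs_integral_le_of_abs_le {Ω : Type*} [MeasurableSpace Ω] {P : Measure Ω}
    [IsProbabilityMeasure P] {g : Ω → ℝ} {K : ℝ} (hK : ∀ ω, |g ω| ≤ K) : |∫ ω, g ω ∂P| ≤ K := by
  simpa using norm_integral_le_of_norm_le_const (f := g) (C := K) (ae_of_all P hK)

section PoissonSolution

open scoped NNReal

variable {M : ℕ} {H : Matrix (Fin M) (Fin M) ℝ} {E : Type*} {φ : Fin M → E → ℝ}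

/-- The solution `q` of the Poisson equation `q r y - ∑ s, H r s * q s y = φ r y`, for every value
of the parameter `y`. -/
noncomputable def poissonSolution (H : Matrix (Fin M) (Fin M) ℝ) (φ : Fin M → E → ℝ) (r : Fin M)
    (y : E) : ℝ :=
  (fundamentalMatrix H *ᵥ fun s => φ s y) r

/-- The bound for the norm of the fundamental matrix on `ℓ^∞` that `abs_fundamentalMatrix_le`
entails. -/
noncomputable def poissonBound (H : Matrix (Fin M) (Fin M) ℝ) : ℝ :=
  M * ((2 * (M : ℝ) ^ 2 + 2) * (1 / (1 - secondModulus H)))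

namespace IsErgodicUniform

theorem poissonBound_nonneg (hH : IsErgodicUniform H) : 0 ≤ poissonBound H :=
  mul_nonneg M.cast_nonneg (mul_nonneg (by positivity)
    (one_div_nonneg.mpr (sub_nonneg.mpr hH.secondModulus_lt_one.le)))

theorem poissonSolution_sub_mulVec (hH : IsErgodicUniform H) {y : E} (hφ : ∑ s, φ s y = 0)
    (r : Fin M) :
    poissonSolution H φ r y - (H *ᵥ fun s => poissonSolution H φ s y) r = φ r y :=
  congrFun (hH.poisson_equation hφ) r

theorem abs_fundamentalMatrix_mulVec_le (hH : IsErgodicUniform H) {v : Fin M → ℝ} {b : ℝ}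
    (hv : ∀ s, |v s| ≤ b) (r : Fin M) : |(fundamentalMatrix H *ᵥ v) r| ≤ poissonBound H * b :=
  calc |(fundamentalMatrix H *ᵥ v) r| ≤ ∑ s, |fundamentalMatrix H r s * v s| :=
        Finset.abs_sum_le_sum_abs (fun s => fundamentalMatrix H r s * v s) Finset.univ
    _ ≤ ∑ _s : Fin M, (2 * (M : ℝ) ^ 2 + 2) * (1 / (1 - secondModulus H)) * b :=
        Finset.sum_le_sum fun s _ => by
          have hle := hH.abs_fundamentalMatrix_le r s
          rw [abs_mul]
          exact mul_le_mul hle (hv s) (abs_nonneg _) ((abs_nonneg _).trans hle)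
    _ = poissonBound H * b := by simp [poissonBound, mul_assoc]

theorem abs_poissonSolution_le (hH : IsErgodicUniform H) {Q : ℝ} (hφ : ∀ s y, |φ s y| ≤ Q)
    (r : Fin M) (y : E) : |poissonSolution H φ r y| ≤ poissonBound H * Q :=
  hH.abs_fundamentalMatrix_mulVec_le (fun s => hφ s y) r

theorem abs_poissonSolution_sub_le [PseudoMetricSpace E] (hH : IsErgodicUniform H) {Λ : ℝ≥0}
    (hφ : ∀ s, LipschitzWith Λ (φ s)) (r : Fin M) (y z : E) :
    |poissonSolution H φ r y - poissonSolution H φ r z| ≤ poissonBound H * (Λ * dist y z) := by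
  have hsub : poissonSolution H φ r y - poissonSolution H φ r z
      = (fundamentalMatrix H *ᵥ ((fun s => φ s y) - fun s => φ s z)) r := by
    rw [Matrix.mulVec_sub]
    rfl
  rw [hsub]
  exact hH.abs_fundamentalMatrix_mulVec_le (fun s => (hφ s).dist_le_mul y z) r

end IsErgodicUniform

theorem measurable_poissonSolution [MeasurableSpace E] (hφ : ∀ s, Measurable (φ s)) (r : Fin M) :
    Measurable (poissonSolution H φ r) :=
  Finset.measurable_fun_sum Finset.univ fun s _ => (hφ s).const_mul (fundamentalMatrix H r s)

end PoissonSolution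

namespace IsMarkovChain

variable {Ω : Type*} [mΩ : MeasurableSpace Ω] {P : Measure Ω} [IsProbabilityMeasure P] {M : ℕ}
  {ℱ : ℕ → MeasurableSpace Ω} {H : Matrix (Fin M) (Fin M) ℝ} {X : ℕ → Ω → Fin M} {k : ℕ}

theorem setIntegral_inter (hX : IsMarkovChain P ℱ H X) (hℱ : ℱ k ≤ mΩ) {r s : Fin M}
    (hH : 0 ≤ H r s) {Y : Ω → ℝ} (hY : Measurable[ℱ k] Y) :
    ∫ ω in {ω | X k ω = r} ∩ {ω | X (k + 1) ω = s}, Y ω ∂P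
      = H r s * ∫ ω in {ω | X k ω = r}, Y ω ∂P := by
  have htrim : (P.restrict ({ω | X k ω = r} ∩ {ω | X (k + 1) ω = s})).trim hℱ
      = (ENNReal.ofReal (H r s) • P.restrict {ω | X k ω = r}).trim hℱ := by
    refine @Measure.ext _ (ℱ k) _ _ fun A hA => ?_
    have hmarkov := hX k r s A hA
    rw [measureReal_def, measureReal_def] at hmarkov
    rw [trim_measurableSet_eq hℱ hA, trim_measurableSet_eq hℱ hA, Measure.smul_apply,
      Measure.restrict_apply (hℱ A hA), Measure.restrict_apply (hℱ A hA), smul_eq_mul,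
      ← Set.inter_assoc, ← ENNReal.toReal_eq_toReal_iff' (measure_ne_top _ _)
        (ENNReal.mul_ne_top ENNReal.ofReal_ne_top (measure_ne_top _ _)), hmarkov,
      ENNReal.toReal_mul, ENNReal.toReal_ofReal hH, mul_comm]
  have hYs : StronglyMeasurable[ℱ k] Y := hY.stronglyMeasurable
  rw [integral_trim hℱ hYs, htrim, ← integral_trim hℱ hYs, integral_smul_measure,
    ENNReal.toReal_ofReal hH, smul_eq_mul]

theorem integral_next (hX : IsMarkovChain P ℱ H X) (hXm : ∀ k, Measurable (X k)) (hℱ : ℱ k ≤ mΩ)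
    (hH : ∀ r s, 0 ≤ H r s) {Y : Fin M → Ω → ℝ} (hY : ∀ s, Measurable[ℱ k] (Y s))
    (hYi : ∀ s, Integrable (Y s) P) :
    ∫ ω, Y (X (k + 1) ω) ω ∂P = ∫ ω, (H *ᵥ fun s => Y s ω) (X k ω) ∂P := by
  have hr (r : Fin M) : MeasurableSet {ω | X k ω = r} := hXm k (measurableSet_singleton r)
  have hs (s : Fin M) : MeasurableSet {ω | X (k + 1) ω = s} :=
    hXm (k + 1) (measurableSet_singleton s)
  have hnext (ω : Ω) : Y (X (k + 1) ω) ω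
      = ∑ r, ∑ s, Set.indicator ({ω | X k ω = r} ∩ {ω | X (k + 1) ω = s}) (Y s) ω := by
    simp [Set.indicator_apply, ite_and]
  have hnow (ω : Ω) : (H *ᵥ fun s => Y s ω) (X k ω)
      = ∑ r, ∑ s, H r s * Set.indicator {ω | X k ω = r} (Y s) ω := by
    rw [Finset.sum_comm]
    simp [Matrix.mulVec, dotProduct, Set.indicator_apply]
  have hinext (r s : Fin M) : Integrable
      (Set.indicator ({ω | X k ω = r} ∩ {ω | X (k + 1) ω = s}) (Y s)) P :=
    (hYi s).indicator ((hr r).inter (hs s))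
  have hinow (r s : Fin M) : Integrable
      (fun ω => H r s * Set.indicator {ω | X k ω = r} (Y s) ω) P :=
    ((hYi s).indicator (hr r)).const_mul (H r s)
  simp only [hnext, hnow]
  rw [integral_finsetSum _ fun r _ => integrable_finsetSum _ fun s _ => hinext r s,
    integral_finsetSum _ fun r _ => integrable_finsetSum _ fun s _ => hinow r s]
  refine Finset.sum_congr rfl fun r _ => ?_
  rw [integral_finsetSum _ fun s _ => hinext r s, integral_finsetSum _ fun s _ => hinow r s]
  refine Finset.sum_congr rfl fun s _ => ?_
  rw [integral_indicator ((hr r).inter (hs s)), integral_const_mul, integral_indicator (hr r),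
    hX.setIntegral_inter hℱ (hH r s) (hY s)]

variable {E : Type*} [MeasurableSpace E] {φ : Fin M → E → ℝ} {Q : ℝ}

theorem integral_eq_integral_poissonSolution_sub (hX : IsMarkovChain P ℱ H X)
    (hXm : ∀ k, Measurable (X k)) (hℱ : ℱ k ≤ mΩ) (hH : IsErgodicUniform H)
    (hφm : ∀ s, Measurable (φ s)) (hφ0 : ∀ y, ∑ s, φ s y = 0) (hφ : ∀ s y, |φ s y| ≤ Q)
    {Y : Ω → E} (hY : Measurable[ℱ k] Y) :
    ∫ ω, φ (X k ω) (Y ω) ∂P = ∫ ω, poissonSolution H φ (X k ω) (Y ω) ∂P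
      - ∫ ω, poissonSolution H φ (X (k + 1) ω) (Y ω) ∂P := by
  have hqm := measurable_poissonSolution (H := H) hφm
  have hYm : Measurable Y := hY.mono hℱ le_rfl
  have hiφ : Integrable (fun ω => φ (X k ω) (Y ω)) P :=
    .of_bound (measurable_apply_index hφm (hXm k) hYm).aestronglyMeasurable Q
      (ae_of_all _ fun ω => hφ _ _)
  have hiq {J : Ω → Fin M} (hJ : Measurable J) :
      Integrable (fun ω => poissonSolution H φ (J ω) (Y ω)) P :=
    .of_bound (measurable_apply_index hqm hJ hYm).aestronglyMeasurable (poissonBound H * Q)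
      (ae_of_all _ fun ω => hH.abs_poissonSolution_le hφ _ _)
  rw [hX.integral_next hXm hℱ (fun r s => Matrix.nonneg_of_mem_rowStochastic hH.stochastic)
    (Y := fun s ω => poissonSolution H φ s (Y ω)) (fun s => (hqm s).comp hY)
    fun s => hiq measurable_const, eq_sub_iff_add_eq, ← integral_add hiφ]
  · exact integral_congr_ae (ae_of_all _ fun ω => by
      linarith [hH.poissonSolution_sub_mulVec (hφ0 (Y ω)) (X k ω)])
  · refine ((hiq (hXm k)).sub hiφ).congr (ae_of_all _ fun ω => ?_)
    exact sub_eq_iff_eq_add'.mpr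
      (sub_eq_iff_eq_add.mp (hH.poissonSolution_sub_mulVec (hφ0 (Y ω)) (X k ω)))

open scoped NNReal in
theorem abs_sum_mul_integral_le [PseudoMetricSpace E] [OpensMeasurableSpace E] {Λ : ℝ≥0}
    (hX : IsMarkovChain P ℱ H X) (hXm : ∀ k, Measurable (X k)) (hℱ : ∀ k, ℱ k ≤ mΩ)
    (hH : IsErgodicUniform H) (hφ0 : ∀ y, ∑ s, φ s y = 0) (hφ : ∀ s y, |φ s y| ≤ Q)
    (hφΛ : ∀ s, LipschitzWith Λ (φ s)) {Y : ℕ → Ω → E} (hY : ∀ k, Measurable[ℱ k] (Y k))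
    {γ : ℕ → ℝ} {c : ℝ} (hγ : Antitone γ) (hγ0 : ∀ k, 0 ≤ γ k)
    (hYγ : ∀ k ω, dist (Y (k + 1) ω) (Y k ω) ≤ c * γ k) (N : ℕ) :
    |∑ k ∈ Finset.range N, γ k * ∫ ω, φ (X k ω) (Y k ω) ∂P|
      ≤ poissonBound H * (3 * Q * γ 0 + Λ * c * ∑ k ∈ Finset.range N, γ k ^ 2) := by
  have hφm (s : Fin M) : Measurable (φ s) := (hφΛ s).continuous.measurable
  have hqm := measurable_poissonSolution (H := H) hφm
  have hiq (k : ℕ) {l : ℕ} (hYl : Measurable (Y l)) :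
      Integrable (fun ω => poissonSolution H φ (X k ω) (Y l ω)) P :=
    .of_bound (measurable_apply_index hqm (hXm k) hYl).aestronglyMeasurable (poissonBound H * Q)
      (ae_of_all _ fun ω => hH.abs_poissonSolution_le hφ _ _)
  have hYm (k : ℕ) : Measurable (Y k) := (hY k).mono (hℱ k) le_rfl
  simp only [fun k => hX.integral_eq_integral_poissonSolution_sub hXm (hℱ k) hH hφm hφ0 hφ (hY k)]
  refine (abs_sum_mul_sub_le (Q := poissonBound H * Q) (c := poissonBound H * (Λ * c)) hγ hγ0
    (fun k => abs_integral_le_of_abs_le fun ω => hH.abs_poissonSolution_le hφ _ _)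
    (fun k => ?_) N).trans_eq (by ring)
  rw [← integral_sub (hiq (k + 1) (hYm (k + 1))) (hiq (k + 1) (hYm k))]
  refine abs_integral_le_of_abs_le fun ω => (hH.abs_poissonSolution_sub_le hφΛ _ _ _).trans ?_
  rw [mul_assoc, mul_assoc]
  exact mul_le_mul_of_nonneg_left (mul_le_mul_of_nonneg_left (hYγ k ω) Λ.coe_nonneg)
    hH.poissonBound_nonneg

end IsMarkovChain

/-! ### The random iterates -/

theorem measurable_twoPoint_apply {Ω : Type*} [MeasurableSpace Ω] {n M : ℕ}
    {g : Fin M → Rn n → ℝ} (hg : ∀ s, Continuous (g s)) (δ : ℝ) {J : Ω → Fin M}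
    (hJ : Measurable J) {h : Ω → UnitSphere n} (hh : Measurable h) {X : Ω → Rn n}
    (hX : Measurable X) : Measurable fun ω => twoPoint (g (J ω)) δ (h ω : Rn n) (X ω) := by
  have hmeas (s : Fin M) : Measurable fun p : Rn n × Rn n => twoPoint (g s) δ p.1 p.2 := by
    have := hg s
    unfold twoPoint
    fun_prop
  have hpair : Measurable fun ω => ((h ω : Rn n), X ω) :=
    (measurable_subtype_coe.comp hh).prodMk hX
  exact measurable_apply_index (g := fun s (p : Rn n × Rn n) => twoPoint (g s) δ p.1 p.2)
    (Y := fun ω => ((h ω : Rn n), X ω)) hmeas hJ hpair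

section RandomIterates

variable {Ω : Type*} {n m M : ℕ}

/-- The iterates of zeroth-order DMGD along random samples and directions. -/
noncomputable def randomIterate (W : Matrix (Fin m) (Fin m) ℝ) (f : Fin m → Fin M → Rn n → ℝ)
    (γ δ : ℕ → ℝ) (x₀ : Rn n) (j : Fin m → ℕ → Ω → Fin M) (h : Fin m → ℕ → Ω → UnitSphere n)
    (k : ℕ) (ω : Ω) : Fin m → Rn n :=
  zoDMGD W f γ δ x₀ (fun i l => j i l ω) (fun i l => h i l ω) k

/-- The average `x̄^k` of the random iterates over the nodes. -/
noncomputable def averageIterate (W : Matrix (Fin m) (Fin m) ℝ) (f : Fin m → Fin M → Rn n → ℝ)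
    (γ δ : ℕ → ℝ) (x₀ : Rn n) (j : Fin m → ℕ → Ω → Fin M) (h : Fin m → ℕ → Ω → UnitSphere n)
    (k : ℕ) (ω : Ω) : Rn n :=
  nodeAverage (randomIterate W f γ δ x₀ j h k ω)

variable {W : Matrix (Fin m) (Fin m) ℝ} {f : Fin m → Fin M → Rn n → ℝ} {γ δ : ℕ → ℝ} {x₀ : Rn n}
  {j : Fin m → ℕ → Ω → Fin M} {h : Fin m → ℕ → Ω → UnitSphere n}

theorem measurable_randomIterate [MeasurableSpace Ω] (hf : ∀ i s, Continuous (f i s)) {k : ℕ}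
    (hj : ∀ i l, l < k → Measurable (j i l)) (hh : ∀ i l, l < k → Measurable (h i l)) (i : Fin m) :
    Measurable fun ω => randomIterate W f γ δ x₀ j h k ω i := by
  induction k generalizing i with
  | zero => exact measurable_const
  | succ k ih =>
    have hx := ih (fun i l hl => hj i l (hl.trans k.lt_succ_self))
      fun i l hl => hh i l (hl.trans k.lt_succ_self)
    exact (Finset.measurable_sum _ fun l _ => (hx l).const_smul (W i l)).sub
      ((measurable_twoPoint_apply (hf i) (δ k) (hj i k k.lt_succ_self) (hh i k k.lt_succ_self)
        (hx i)).const_smul (γ k))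

theorem history_le [mΩ : MeasurableSpace Ω] (hj : ∀ i k, Measurable (j i k))
    (hh : ∀ i k, Measurable (h i k)) (k : ℕ) : history j h k ≤ mΩ :=
  iSup_le fun i => iSup_le fun l => iSup_le fun _ => sup_le (hj i l).comap_le (hh i l).comap_le

theorem preHistory_le_history (k : ℕ) : preHistory j h k ≤ history j h k :=
  sup_le
    (iSup_le fun i => iSup_le fun l => iSup_le fun hl =>
      le_iSup_of_le i <| le_iSup_of_le l <| le_iSup_of_le hl le_sup_left)
    (iSup_le fun i => iSup_le fun l => iSup_le fun hl =>
      le_iSup_of_le i <| le_iSup_of_le l <| le_iSup_of_le hl.le le_sup_right)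

theorem measurable_sample_preHistory {k l : ℕ} (hl : l ≤ k) (i : Fin m) :
    Measurable[preHistory j h k] (j i l) :=
  measurable_iff_comap_le.mpr <| le_sup_of_le_left <|
    le_iSup_of_le i <| le_iSup_of_le l <| le_iSup_of_le hl le_rfl

theorem measurable_direction_preHistory {k l : ℕ} (hl : l < k) (i : Fin m) :
    Measurable[preHistory j h k] (h i l) :=
  measurable_iff_comap_le.mpr <| le_sup_of_le_right <|
    le_iSup_of_le i <| le_iSup_of_le l <| le_iSup_of_le hl le_rfl

theorem measurable_randomIterate_preHistory (hf : ∀ i s, Continuous (f i s)) (k : ℕ) (i : Fin m) :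
    Measurable[preHistory j h k] fun ω => randomIterate W f γ δ x₀ j h k ω i :=
  @measurable_randomIterate Ω n m M W f γ δ x₀ j h (preHistory j h k) hf k
    (fun i _ hl => measurable_sample_preHistory hl.le i)
    (fun i _ hl => measurable_direction_preHistory hl i) i

theorem measurable_averageIterate_preHistory (hf : ∀ i s, Continuous (f i s)) (k : ℕ) :
    Measurable[preHistory j h k] (averageIterate W f γ δ x₀ j h k) :=
  (Finset.measurable_sum _ fun i _ => measurable_randomIterate_preHistory hf k i).const_smul
    (1 / (m : ℝ))

open scoped NNReal

variable {B L : ℝ≥0}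

theorem measurable_gradient_averageIterate (hf : ∀ i s, IsSmoothLoss B L (f i s)) (k : ℕ) :
    Measurable[preHistory j h k] fun ω =>
      ∇ (objective f) (averageIterate W f γ δ x₀ j h k ω) :=
  (isSmoothLoss_objective hf).lipschitzWith_gradient.continuous.measurable.comp
    (measurable_averageIterate_preHistory (fun i s => (hf i s).differentiable.continuous) k)

theorem measurable_gradient_randomIterate (hf : ∀ i s, IsSmoothLoss B L (f i s)) (i : Fin m)
    (k : ℕ) : Measurable[preHistory j h k] fun ω =>
      ∇ (f i (j i k ω)) (randomIterate W f γ δ x₀ j h k ω i) :=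
  @measurable_apply_index Ω (Fin M) (Rn n) (Rn n) (preHistory j h k) _ _ _ _ _ (fun s => ∇ (f i s))
    (fun s => (hf i s).lipschitzWith_gradient.continuous.measurable) (j i k)
    (measurable_sample_preHistory le_rfl i) (fun ω => randomIterate W f γ δ x₀ j h k ω i)
    (measurable_randomIterate_preHistory (fun i s => (hf i s).differentiable.continuous) k i)

end RandomIterates

/-! ### The weighted sum of the expected squared gradients -/

theorem integrable_of_abs_le {Ω : Type*} [MeasurableSpace Ω] {P : Measure Ω} [IsFiniteMeasure P]
    {g : Ω → ℝ} (hg : Measurable g) {K : ℝ} (hK : ∀ ω, |g ω| ≤ K) : Integrable g P :=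
  .of_bound hg.aestronglyMeasurable K (ae_of_all P hK)

section Expectation

open scoped NNReal

variable {Ω : Type*} [mΩ : MeasurableSpace Ω] {P : Measure Ω} {n m M : ℕ}
  {W : Matrix (Fin m) (Fin m) ℝ} {H : Matrix (Fin M) (Fin M) ℝ} {B L : ℝ≥0}
  {f : Fin m → Fin M → Rn n → ℝ} {γ δ : ℕ → ℝ} {x₀ : Rn n} {j : Fin m → ℕ → Ω → Fin M}
  {h : Fin m → ℕ → Ω → UnitSphere n}

theorem IsSampling.preHistory_le (hs : IsSampling P H j h) (k : ℕ) : preHistory j h k ≤ mΩ :=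
  (preHistory_le_history k).trans (history_le hs.measurable_sample hs.measurable_direction k)

theorem IsSampling.measurable_averageIterate (hs : IsSampling P H j h)
    (hf : ∀ i s, IsSmoothLoss B L (f i s)) (k : ℕ) :
    Measurable (averageIterate W f γ δ x₀ j h k) :=
  (measurable_averageIterate_preHistory (fun i s => (hf i s).differentiable.continuous) k).mono
    (hs.preHistory_le k) le_rfl

variable [IsProbabilityMeasure P]

theorem IsSampling.integrable_inner_mul_inner (hs : IsSampling P H j h) {g u : Ω → Rn n}
    (hg : Measurable g) (hu : Measurable u) (hgB : ∀ ω, ‖g ω‖ ≤ B) (huB : ∀ ω, ‖u ω‖ ≤ B)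
    (i : Fin m) (k : ℕ) :
    Integrable (fun ω => inner ℝ (g ω) (h i k ω : Rn n) * inner ℝ (u ω) (h i k ω : Rn n)) P :=
  have hh : Measurable fun ω => (h i k ω : Rn n) :=
    measurable_subtype_coe.comp (hs.measurable_direction i k)
  integrable_of_abs_le ((hg.inner hh).mul (hu.inner hh)) fun ω =>
    abs_inner_mul_inner_le (hgB ω) (huB ω) (h i k ω)

theorem integrable_inner_of_norm_le {g u : Ω → Rn n} (hg : Measurable g) (hu : Measurable u)
    (hgB : ∀ ω, ‖g ω‖ ≤ B) (huB : ∀ ω, ‖u ω‖ ≤ B) :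
    Integrable (fun ω => inner ℝ (u ω) (g ω)) P :=
  integrable_of_abs_le (hu.inner hg) fun ω => (abs_real_inner_le_norm _ _).trans
    (mul_le_mul (huB ω) (hgB ω) (norm_nonneg _) B.coe_nonneg)

theorem IsSampling.integrable_directionDeviation (hs : IsSampling P H j h) {g u : Ω → Rn n}
    (hg : Measurable g) (hu : Measurable u) (hgB : ∀ ω, ‖g ω‖ ≤ B) (huB : ∀ ω, ‖u ω‖ ≤ B)
    (i : Fin m) (k : ℕ) : Integrable (fun ω => directionDeviation (g ω) (u ω) (h i k ω)) P :=
  ((hs.integrable_inner_mul_inner hg hu hgB huB i k).const_mul _).sub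
    (integrable_inner_of_norm_le hg hu hgB huB)

theorem IsSampling.integral_directionDeviation (hs : IsSampling P H j h) (i : Fin m) (k : ℕ)
    {g u : Ω → Rn n} (hg : Measurable[preHistory j h k] g) (hu : Measurable[preHistory j h k] u)
    (hgB : ∀ ω, ‖g ω‖ ≤ B) (huB : ∀ ω, ‖u ω‖ ≤ B) :
    ∫ ω, directionDeviation (g ω) (u ω) (h i k ω) ∂P = 0 := by
  rcases n.eq_zero_or_pos with rfl | hn
  · simp [directionDeviation, Subsingleton.elim (g _) 0]
  have hg' := hg.mono (hs.preHistory_le k) le_rfl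
  have hu' := hu.mono (hs.preHistory_le k) le_rfl
  have hprod := hs.integrable_inner_mul_inner hg' hu' hgB huB i k
  have hmean := integral_inner_mul_inner_of_indep (hs.preHistory_le k)
    (hs.measurable_direction i k) (hs.uniform i k) (hs.indep i k) hg hu hprod
  have hn' : (n : ℝ) ≠ 0 := Nat.cast_ne_zero.mpr hn.ne'
  simp only [directionDeviation]
  rw [integral_sub (hprod.const_mul _) (integrable_inner_of_norm_le hg' hu' hgB huB),
    integral_const_mul, hmean, mul_div_cancel₀ _ hn', sub_eq_zero]
  simp only [real_inner_comm]

theorem IsSampling.integrable_sampleDeviation (hs : IsSampling P H j h)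
    (hf : ∀ i s, IsSmoothLoss B L (f i s)) (i : Fin m) (k : ℕ) :
    Integrable (fun ω => sampleDeviation f i (j i k ω) (averageIterate W f γ δ x₀ j h k ω)) P :=
  integrable_of_abs_le (measurable_apply_index
    (fun s => (lipschitzWith_sampleDeviation hf i s).continuous.measurable)
    (hs.measurable_sample i k) (hs.measurable_averageIterate hf k))
    fun ω => abs_sampleDeviation_le hf i (j i k ω) _

theorem IsSampling.abs_sum_mul_integral_sampleDeviation_le (hs : IsSampling P H j h)
    (hW : IsGossipMatrix W) (hH : IsErgodicUniform H) (hf : ∀ i s, IsSmoothLoss B L (f i s))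
    (hγ : Antitone γ) (hγ0 : ∀ k, 0 ≤ γ k) (hδ : ∀ k, 0 < δ k) (i : Fin m) (N : ℕ) :
    |∑ k ∈ Finset.range N, γ k *
        ∫ ω, sampleDeviation f i (j i k ω) (averageIterate W f γ δ x₀ j h k ω) ∂P|
      ≤ poissonBound H * (3 * (2 * (B : ℝ) ^ 2) * γ 0
          + 4 * B * L * (n * B) * ∑ k ∈ Finset.range N, γ k ^ 2) :=
  (hs.markov i).abs_sum_mul_integral_le (hs.measurable_sample i)
    (history_le hs.measurable_sample hs.measurable_direction) hH (sum_sampleDeviation hf i)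
    (abs_sampleDeviation_le hf i) (lipschitzWith_sampleDeviation hf i)
    (fun k => (measurable_averageIterate_preHistory
      (fun i s => (hf i s).differentiable.continuous) k).mono (preHistory_le_history k) le_rfl)
    hγ hγ0 (fun k _ => (dist_eq_norm _ _).trans_le
      (norm_nodeAverage_zoDMGD_succ_sub_le hW hf hγ0 hδ _ _ k)) N

theorem IsSampling.sum_mul_integral_sq_add_le (hs : IsSampling P H j h) (hm : 0 < m)
    (hW : IsGossipMatrix W) (hf : ∀ i s, IsSmoothLoss B L (f i s)) (hγ : Antitone γ)
    (hγ0 : ∀ k, 0 ≤ γ k) (hδ : ∀ k, 0 < δ k) {D : ℝ}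
    (hD : ∀ x, objective f x₀ - objective f x ≤ D) (N : ℕ) :
    ∑ k ∈ Finset.range N, γ k *
        (∫ ω, ‖∇ (objective f) (averageIterate W f γ δ x₀ j h k ω)‖ ^ 2 ∂P + (1 / (m : ℝ)) *
          ∑ i, ∫ ω, sampleDeviation f i (j i k ω) (averageIterate W f γ δ x₀ j h k ω) ∂P)
      ≤ D + (L * (n * B) ^ 2 + B * L * (2 * m * (n * B) * (1 / (1 - secondModulus W))))
            * ∑ k ∈ Finset.range N, γ k ^ 2
          + B * n * L * ∑ k ∈ Finset.range N, γ k * δ k := by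
  set y := averageIterate W f γ δ x₀ j h
  set U : ℕ → Ω → Rn n := fun k ω => ∇ (objective f) (y k ω)
  set G : Fin m → ℕ → Ω → Rn n := fun i k ω =>
    ∇ (f i (j i k ω)) (randomIterate W f γ δ x₀ j h k ω i)
  have hUm k : Measurable[preHistory j h k] (U k) := measurable_gradient_averageIterate hf k
  have hGm i k : Measurable[preHistory j h k] (G i k) := measurable_gradient_randomIterate hf i k
  have hUB k ω : ‖U k ω‖ ≤ B := (isSmoothLoss_objective hf).norm_gradient_le _
  have hGB i k ω : ‖G i k ω‖ ≤ B := (hf i _).norm_gradient_le _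
  have hUint k : Integrable (fun ω => ‖U k ω‖ ^ 2) P := by
    simpa only [real_inner_self_eq_norm_sq] using integrable_inner_of_norm_le
      ((hUm k).mono (hs.preHistory_le k) le_rfl) ((hUm k).mono (hs.preHistory_le k) le_rfl)
      (hUB k) (hUB k)
  have hSint i k := hs.integrable_sampleDeviation (W := W) (γ := γ) (δ := δ) (x₀ := x₀) hf i k
  have hDint i k : Integrable (fun ω => directionDeviation (G i k ω) (U k ω) (h i k ω)) P :=
    hs.integrable_directionDeviation ((hGm i k).mono (hs.preHistory_le k) le_rfl)
      ((hUm k).mono (hs.preHistory_le k) le_rfl) (hGB i k) (hUB k) i k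
  have hSDint k := (integrable_finsetSum Finset.univ fun i _ =>
    (hSint i k).add (hDint i k)).const_mul (1 / (m : ℝ))
  have hmean := integral_mono (μ := P)
    (integrable_finsetSum (Finset.range N) fun k _ =>
      ((hUint k).add (hSDint k)).const_mul (γ k)) (integrable_const _)
    fun ω => sum_mul_sq_norm_gradient_nodeAverage_add_le hm hW hf hγ hγ0 hδ hD
      (fun i l => j i l ω) (fun i l => h i l ω) N
  rw [integral_finsetSum _ fun k _ => ((hUint k).add (hSDint k)).const_mul (γ k),
    integral_const, probReal_univ, one_smul] at hmean
  refine (Finset.sum_congr rfl fun k _ => ?_).trans_le hmean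
  rw [integral_const_mul, integral_add' (hUint k) (hSDint k), integral_const_mul,
    integral_finsetSum _ fun i _ => (hSint i k).add (hDint i k)]
  congr! 4 with i
  rw [integral_add' (hSint i k) (hDint i k),
    hs.integral_directionDeviation i k (hGm i k) (hUm k) (hGB i k) (hUB k), add_zero]

theorem IsSampling.sum_mul_integral_sq_le (hs : IsSampling P H j h) (hm : 0 < m)
    (hW : IsGossipMatrix W) (hH : IsErgodicUniform H) (hf : ∀ i s, IsSmoothLoss B L (f i s))
    (hγ : Antitone γ) (hγ0 : ∀ k, 0 ≤ γ k) (hδ : ∀ k, 0 < δ k) {D : ℝ}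
    (hD : ∀ x, objective f x₀ - objective f x ≤ D) (N : ℕ) :
    ∑ k ∈ Finset.range N, γ k *
        ∫ ω, ‖∇ (objective f) (averageIterate W f γ δ x₀ j h k ω)‖ ^ 2 ∂P
      ≤ D + (L * (n * B) ^ 2 + B * L * (2 * m * (n * B) * (1 / (1 - secondModulus W))))
            * ∑ k ∈ Finset.range N, γ k ^ 2
          + B * n * L * ∑ k ∈ Finset.range N, γ k * δ k
          + poissonBound H * (3 * (2 * (B : ℝ) ^ 2) * γ 0
              + 4 * B * L * (n * B) * ∑ k ∈ Finset.range N, γ k ^ 2) := by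
  have hdescent := hs.sum_mul_integral_sq_add_le hm hW hf hγ hγ0 hδ hD N
  have hnode (i : Fin m) := hs.abs_sum_mul_integral_sampleDeviation_le (x₀ := x₀) hW hH hf hγ hγ0
    hδ i N
  simp only [← Real.norm_eq_abs] at hnode
  have hsampling := norm_average_le ((norm_nonneg _).trans (hnode ⟨0, hm⟩)) hnode
  rw [Real.norm_eq_abs, smul_eq_mul, Finset.sum_comm] at hsampling
  have hlower := neg_le_of_abs_le hsampling
  simp only [mul_add, Finset.sum_add_distrib, mul_left_comm (γ _), ← Finset.mul_sum]
    at hdescent hlower ⊢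
  linarith

end Expectation

/-! ### The convergence rate -/

section Rate

open scoped NNReal

variable {n m M : ℕ} {W : Matrix (Fin m) (Fin m) ℝ} {H : Matrix (Fin M) (Fin M) ℝ} {B L : ℝ≥0}

theorem IsErgodicUniform.one_le_one_div_log (hH : IsErgodicUniform H) :
    1 ≤ 1 / Real.log (1 / lambdaH H) :=
  (one_le_one_div (sub_pos.mpr hH.secondModulus_lt_one)
    (sub_le_self 1 (secondModulus_nonneg H))).trans hH.one_div_gap_le

theorem IsGossipMatrix.one_le_one_div_gap (hW : IsGossipMatrix W) :
    1 ≤ 1 / (1 - secondModulus W) :=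
  one_le_one_div (sub_pos.mpr hW.secondModulus_lt_one) (sub_le_self 1 (secondModulus_nonneg W))

/-- The numerator of the convergence rate: the dependence of the bound on the dimension, the network
and the Markov chain. -/
noncomputable def rateFactor (n : ℕ) (W : Matrix (Fin m) (Fin m) ℝ)
    (H : Matrix (Fin M) (Fin M) ℝ) : ℝ :=
  (1 / Real.log (1 / lambdaH H)) * (1 / (1 - secondModulus W)) + (n : ℝ) ^ (3 / 2 : ℝ)

theorem IsGossipMatrix.rateFactor_nonneg (hW : IsGossipMatrix W) (hH : IsErgodicUniform H) :
    0 ≤ rateFactor n W H :=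
  add_nonneg (mul_nonneg (zero_le_one.trans hH.one_le_one_div_log)
    (zero_le_one.trans hW.one_le_one_div_gap)) (by positivity)

/-- The bound for the weighted sum of the squared gradients, up to the square of `rateFactor`. Here
`D`, `S` and `Γ` bound the initial gap `f x⁰ - inf f`, the sum of the `γ k * δ k`, and the sum of
the `γ k ^ 2`. -/
noncomputable def rateConstant (m M : ℕ) (B L : ℝ≥0) (D S Γ : ℝ) : ℝ :=
  D + (L * B ^ 2 + B * L * (2 * m * B)) * Γ + B * L * S
    + M * (2 * (M : ℝ) ^ 2 + 2) * (3 * (2 * (B : ℝ) ^ 2) + 4 * B * L * B * Γ)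

theorem natCast_le_rpow (n : ℕ) : (n : ℝ) ≤ (n : ℝ) ^ (3 / 2 : ℝ) := by
  rcases n.eq_zero_or_pos with rfl | hn
  · simp
  · exact Real.self_le_rpow_of_one_le (Nat.one_le_cast.mpr hn) (by norm_num)

theorem weightedSum_le_rateConstant_mul {D S Γ : ℝ} (hW : IsGossipMatrix W)
    (hH : IsErgodicUniform H) (hD : 0 ≤ D) (hS : 0 ≤ S) (hΓ : 0 ≤ Γ) :
    D + (L * (n * B) ^ 2 + B * L * (2 * m * (n * B) * (1 / (1 - secondModulus W)))) * Γ
        + B * n * L * S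
        + poissonBound H * (3 * (2 * (B : ℝ) ^ 2) * 1 + 4 * B * L * (n * B) * Γ)
      ≤ rateConstant m M B L D S Γ * rateFactor n W H ^ 2 := by
  have ha := hH.one_le_one_div_log
  have hb := hW.one_le_one_div_gap
  have hn := natCast_le_rpow n
  have : (0 : ℝ) ≤ n := n.cast_nonneg
  set a := 1 / Real.log (1 / lambdaH H)
  set b := 1 / (1 - secondModulus W)
  have hT : rateFactor n W H = a * b + (n : ℝ) ^ (3 / 2 : ℝ) := rfl
  set T := rateFactor n W H
  have hTa : a ≤ T := by nlinarith
  have hTb : b ≤ T := by nlinarith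
  have hTn : n ≤ T := by nlinarith
  have hT1 : 1 ≤ T := ha.trans hTa
  have hTH : 1 / (1 - secondModulus H) ≤ T := hH.one_div_gap_le.trans hTa
  calc _ ≤ D * T ^ 2 + (L * (T * B) ^ 2 + B * L * (2 * m * (T * B) * T)) * Γ
        + B * T ^ 2 * L * S
        + M * ((2 * (M : ℝ) ^ 2 + 2) * T)
          * (3 * (2 * (B : ℝ) ^ 2) * T + 4 * B * L * (T * B) * Γ) := by
        unfold poissonBound
        gcongr
        · exact le_mul_of_one_le_right hD (one_le_pow₀ hT1)
        · exact hTn.trans (le_self_pow₀ hT1 two_ne_zero)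
    _ = _ := by
        unfold rateConstant
        ring

end Rate

section Convergence

open scoped NNReal

variable {Ω : Type*} [MeasurableSpace Ω] {P : Measure Ω} [IsProbabilityMeasure P] {n m M : ℕ}
  {W : Matrix (Fin m) (Fin m) ℝ} {H : Matrix (Fin M) (Fin M) ℝ} {B L : ℝ≥0}
  {f : Fin m → Fin M → Rn n → ℝ} {γ δ : ℕ → ℝ} {x₀ : Rn n} {j : Fin m → ℕ → Ω → Fin M}
  {h : Fin m → ℕ → Ω → UnitSphere n} {θ D S : ℝ}

theorem sq_integral_le_integral_sq {g : Ω → ℝ} (hg : MemLp g 2 P) :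
    (∫ ω, g ω ∂P) ^ 2 ≤ ∫ ω, g ω ^ 2 ∂P :=
  sub_nonneg.mp ((variance_nonneg g P).trans_eq (variance_eq_sub hg))

theorem IsSampling.memLp_norm_gradient_averageIterate (hs : IsSampling P H j h)
    (hf : ∀ i s, IsSmoothLoss B L (f i s)) (k : ℕ) (p : ENNReal) :
    MemLp (fun ω => ‖∇ (objective f) (averageIterate W f γ δ x₀ j h k ω)‖) p P :=
  .of_bound ((measurable_gradient_averageIterate hf k).mono (hs.preHistory_le k)
    le_rfl).norm.aestronglyMeasurable B
    (ae_of_all P fun _ => (norm_norm _).trans_le ((isSmoothLoss_objective hf).norm_gradient_le _))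

theorem IsSampling.integrable_norm_gradient_averageIterate (hs : IsSampling P H j h)
    (hf : ∀ i s, IsSmoothLoss B L (f i s)) (k : ℕ) :
    Integrable (fun ω => ‖∇ (objective f) (averageIterate W f γ δ x₀ j h k ω)‖) P :=
  memLp_one_iff_integrable.mp (hs.memLp_norm_gradient_averageIterate hf k 1)

theorem IsSampling.sum_stepSize_mul_sq_integral_le (hs : IsSampling P H j h) (hm : 0 < m)
    (hW : IsGossipMatrix W) (hH : IsErgodicUniform H) (hf : ∀ i s, IsSmoothLoss B L (f i s))
    (hθ : 1 / 2 < θ) (hδ : ∀ k, 0 < δ k) (hδs : Summable fun k => stepSize θ k * δ k)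
    (hS : ∑' k, stepSize θ k * δ k ≤ S) (hD : ∀ x, objective f x₀ - objective f x ≤ D) (N : ℕ) :
    ∑ k ∈ Finset.range N, stepSize θ k *
        (∫ ω, ‖∇ (objective f) (averageIterate W f (stepSize θ) δ x₀ j h k ω)‖ ∂P) ^ 2
      ≤ rateConstant m M B L D S (∑' k, stepSize θ k ^ 2) * rateFactor n W H ^ 2 := by
  have hD0 : 0 ≤ D := (sub_self (objective f x₀)).ge.trans (hD x₀)
  have hγδ0 (k : ℕ) : 0 ≤ stepSize θ k * δ k := mul_nonneg (stepSize_nonneg θ k) (hδ k).le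
  have hS0 : 0 ≤ S := (tsum_nonneg hγδ0).trans hS
  have hΓ0 : 0 ≤ ∑' k, stepSize θ k ^ 2 := tsum_nonneg fun k => sq_nonneg _
  have hSN : ∑ k ∈ Finset.range N, stepSize θ k * δ k ≤ S :=
    (hδs.sum_le_tsum _ fun k _ => hγδ0 k).trans hS
  have hΓN : ∑ k ∈ Finset.range N, stepSize θ k ^ 2 ≤ ∑' k, stepSize θ k ^ 2 :=
    (summable_stepSize_pow (by push_cast; linarith)).sum_le_tsum _ fun k _ => sq_nonneg _
  have hgap : 0 ≤ 1 - secondModulus W := sub_nonneg.mpr hW.secondModulus_lt_one.le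
  have hpoisson := hH.poissonBound_nonneg
  calc ∑ k ∈ Finset.range N, stepSize θ k *
        (∫ ω, ‖∇ (objective f) (averageIterate W f (stepSize θ) δ x₀ j h k ω)‖ ∂P) ^ 2
    _ ≤ ∑ k ∈ Finset.range N, stepSize θ k *
        ∫ ω, ‖∇ (objective f) (averageIterate W f (stepSize θ) δ x₀ j h k ω)‖ ^ 2 ∂P := by
        gcongr with k
        · exact stepSize_nonneg θ k
        · exact sq_integral_le_integral_sq (hs.memLp_norm_gradient_averageIterate hf k 2)
    _ ≤ _ := hs.sum_mul_integral_sq_le hm hW hH hf (stepSize_antitone (by linarith))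
        (stepSize_nonneg θ) hδ hD N
    _ ≤ _ := by
        rw [stepSize_zero]
        gcongr
    _ ≤ _ := weightedSum_le_rateConstant_mul hW hH hD0 hS0 hΓ0

theorem IsSampling.abs_integral_norm_gradient_succ_sub_le (hs : IsSampling P H j h)
    (hW : IsGossipMatrix W) (hf : ∀ i s, IsSmoothLoss B L (f i s)) (hγ0 : ∀ k, 0 ≤ γ k)
    (hδ : ∀ k, 0 < δ k) (k : ℕ) :
    |∫ ω, ‖∇ (objective f) (averageIterate W f γ δ x₀ j h (k + 1) ω)‖ ∂P
        - ∫ ω, ‖∇ (objective f) (averageIterate W f γ δ x₀ j h k ω)‖ ∂P|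
      ≤ L * (n * B) * γ k := by
  rw [← integral_sub (hs.integrable_norm_gradient_averageIterate hf _)
    (hs.integrable_norm_gradient_averageIterate hf _)]
  refine abs_integral_le_of_abs_le fun ω => (abs_norm_sub_norm_le _ _).trans ?_
  rw [mul_assoc]
  exact ((isSmoothLoss_objective hf).lipschitzWith_gradient.norm_sub_le _ _).trans
    (mul_le_mul_of_nonneg_left (norm_nodeAverage_zoDMGD_succ_sub_le hW hf hγ0 hδ _ _ k)
      L.coe_nonneg)

theorem IsSampling.tendsto_integral_norm_gradient_averageIterate (hs : IsSampling P H j h)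
    (hm : 0 < m) (hW : IsGossipMatrix W) (hH : IsErgodicUniform H)
    (hf : ∀ i s, IsSmoothLoss B L (f i s)) (hθ : 1 / 2 < θ) (hθ' : θ ≤ 1) (hδ : ∀ k, 0 < δ k)
    (hδs : Summable fun k => stepSize θ k * δ k)
    (hD : ∀ x, objective f x₀ - objective f x ≤ D) :
    Tendsto (fun k => ∫ ω, ‖∇ (objective f) (averageIterate W f (stepSize θ) δ x₀ j h k ω)‖ ∂P)
      atTop (𝓝 0) :=
  tendsto_zero_of_summable_mul_sq (stepSize_nonneg θ)
    (mt summable_stepSize_iff.mp hθ'.not_gt)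
    (summable_stepSize_pow (by push_cast; linarith))
    (fun _ => integral_nonneg fun _ => norm_nonneg _)
    (summable_of_sum_range_le (fun k => mul_nonneg (stepSize_nonneg θ k) (sq_nonneg _))
      (hs.sum_stepSize_mul_sq_integral_le hm hW hH hf hθ hδ hδs le_rfl hD))
    (hs.abs_integral_norm_gradient_succ_sub_le hW hf (stepSize_nonneg θ) hδ)

theorem IsSampling.inf'_integral_norm_gradient_averageIterate_le (hs : IsSampling P H j h)
    (hm : 0 < m) (hW : IsGossipMatrix W) (hH : IsErgodicUniform H)
    (hf : ∀ i s, IsSmoothLoss B L (f i s)) (hθ : 1 / 2 < θ) (hθ' : θ ≤ 1) (hδ : ∀ k, 0 < δ k)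
    (hδs : Summable fun k => stepSize θ k * δ k) (hS : ∑' k, stepSize θ k * δ k ≤ S)
    (hD : ∀ x, objective f x₀ - objective f x ≤ D) {k : ℕ} (hk : 1 ≤ k) :
    (Finset.Icc 1 k).inf' (Finset.nonempty_Icc.mpr hk)
        (fun i => ∫ ω, ‖∇ (objective f) (averageIterate W f (stepSize θ) δ x₀ j h i ω)‖ ∂P)
      ≤ 2 * √(rateConstant m M B L D S (∑' k, stepSize θ k ^ 2)) * rateFactor n W H
          / (k : ℝ) ^ ((1 - θ) / 2) := by
  have hsum := hs.sum_stepSize_mul_sq_integral_le hm hW hH hf hθ hδ hδs hS hD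
  have hbound : 0 ≤ rateConstant m M B L D S (∑' k, stepSize θ k ^ 2) * rateFactor n W H ^ 2 := by
    simpa using hsum 0
  have hT := hW.rateFactor_nonneg (n := n) hH
  have hle := inf'_le_of_sum_stepSize_mul_sq_le (by linarith) hθ'
    (fun k => integral_nonneg fun ω => norm_nonneg _) (Real.sqrt_nonneg _)
    (fun N => (hsum N).trans_eq (Real.sq_sqrt hbound).symm) hk
  rwa [Real.sqrt_mul' _ (sq_nonneg _), Real.sqrt_sq hT, ← mul_assoc] at hle

theorem theorem2_general (m M : ℕ) (θ : ℝ) (hθ : 1 / 2 < θ) (hθ' : θ ≤ 1) (B L : ℝ≥0) (D S : ℝ) :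
    ∃ C : ℝ,
      ∀ (n : ℕ) (_ : 0 < m) (W : Matrix (Fin m) (Fin m) ℝ) (_ : IsGossipMatrix W)
        (H : Matrix (Fin M) (Fin M) ℝ) (_ : IsErgodicUniform H)
        (f : Fin m → Fin M → Rn n → ℝ) (_ : ∀ i s, IsSmoothLoss B L (f i s))
        (x₀ : Rn n) (_ : ∀ x, objective f x₀ - objective f x ≤ D)
        (γ δ : ℕ → ℝ) (_ : ∀ k, γ k = 1 / ((k : ℝ) + 1) ^ θ) (_ : ∀ k, 0 < δ k)
        (_ : Summable fun k => γ k * δ k) (_ : ∑' k, γ k * δ k ≤ S)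
        (Ω : Type*) [MeasurableSpace Ω] (P : Measure Ω) [IsProbabilityMeasure P]
        (j : Fin m → ℕ → Ω → Fin M) (h : Fin m → ℕ → Ω → UnitSphere n)
        (_ : IsSampling P H j h)
        (xbar : ℕ → Ω → Rn n)
        (_ : ∀ k ω, xbar k ω =
          nodeAverage (zoDMGD W f γ δ x₀ (fun i l => j i l ω) (fun i l => h i l ω) k)),
        (∀ k, Integrable (fun ω => ‖∇ (objective f) (xbar k ω)‖) P) ∧
        Tendsto (fun k => ∫ ω, ‖∇ (objective f) (xbar k ω)‖ ∂P) atTop (𝓝 0) ∧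
        ∀ (k : ℕ) (hk : 1 ≤ k),
          (Finset.Icc 1 k).inf' (Finset.nonempty_Icc.mpr hk)
              (fun i => ∫ ω, ‖∇ (objective f) (xbar i ω)‖ ∂P)
            ≤ C * ((1 / Real.log (1 / lambdaH H)) * (1 / (1 - secondModulus W))
                    + (n : ℝ) ^ (3 / 2 : ℝ)) / (k : ℝ) ^ ((1 - θ) / 2) := by
  refine ⟨2 * √(rateConstant m M B L D S (∑' k, stepSize θ k ^ 2)), ?_⟩
  intro n hm W hW H hH f hf x₀ hD γ δ hγ hδ hδs hS Ω _ P _ j h hs xbar hxbar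
  obtain rfl : γ = stepSize θ := funext hγ
  obtain rfl : xbar = averageIterate W f (stepSize θ) δ x₀ j h := funext₂ hxbar
  exact ⟨hs.integrable_norm_gradient_averageIterate hf,
    hs.tendsto_integral_norm_gradient_averageIterate hm hW hH hf hθ hθ' hδ hδs hD,
    fun k hk => hs.inf'_integral_norm_gradient_averageIterate_le hm hW hH hf hθ hθ' hδ hδs hS
      hD hk⟩

end Convergence

theorem theorem2 (m M : ℕ) (θ : ℝ) (hθ : 1 / 2 < θ) (hθ' : θ < 1) (B L D S : ℝ) :
    -- the constant depends on `m`, `M`, `θ`, `B`, `L`, `D`, `S` only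
    ∃ C : ℝ,
      ∀ (n : ℕ) (G : SimpleGraph (Fin m)) (_ : G.Connected)
        (W : Matrix (Fin m) (Fin m) ℝ) (_ : IsMixingMatrix G W)
        (H : Matrix (Fin M) (Fin M) ℝ) (_ : IsErgodicUniform H)
        (f : Fin m → Fin M → Rn n → ℝ) (_ : LossAssumptions B L f)
        (x₀ : Rn n) (_ : ∀ x, objective f x₀ - objective f x ≤ D)
        (γ δ : ℕ → ℝ) (_ : ∀ k, γ k = 1 / ((k : ℝ) + 1) ^ θ) (_ : ∀ k, 0 < δ k)
        (_ : Summable fun k => γ k * δ k) (_ : ∑' k, γ k * δ k ≤ S)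
        (Ω : Type*) [MeasurableSpace Ω] (P : Measure Ω) [IsProbabilityMeasure P]
        (j : Fin m → ℕ → Ω → Fin M) (h : Fin m → ℕ → Ω → UnitSphere n)
        (_ : IsSampling P H j h)
        (xbar : ℕ → Ω → Rn n)
        (_ : ∀ k ω, xbar k ω =
          nodeAverage (zoDMGD W f γ δ x₀ (fun i l => j i l ω) (fun i l => h i l ω) k)),
        (∀ k, Integrable (fun ω => ‖∇ (objective f) (xbar k ω)‖) P) ∧
        Tendsto (fun k => ∫ ω, ‖∇ (objective f) (xbar k ω)‖ ∂P) atTop (𝓝 0) ∧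
        ∀ (k : ℕ) (hk : 1 ≤ k),
          (Finset.Icc 1 k).inf' (Finset.nonempty_Icc.mpr hk)
              (fun i => ∫ ω, ‖∇ (objective f) (xbar i ω)‖ ∂P)
            ≤ C * ((1 / Real.log (1 / lambdaH H)) * (1 / (1 - secondModulus W))
                    + (n : ℝ) ^ (3 / 2 : ℝ)) / (k : ℝ) ^ ((1 - θ) / 2) := by
  obtain ⟨C, hC⟩ := theorem2_general m M θ hθ hθ'.le B.toNNReal L.toNNReal D S
  exact ⟨C, fun n G hG W hW H hH f hf =>
    hC n (Fin.pos hG.nonempty.some) W hW.isGossipMatrix H hH f hf.isSmoothLoss⟩
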